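/- Let $\rho\in(-1,1)\setminus\{0\}$, let $\varepsilon\ne 0$ with $\rho+\varepsilon\neq 0$, and let $h\ge 1$ be a fixed integer. Let $(k_n)_{n\ge1}$ be a sequence of break points in $\mathbb N$ with $k_n\to\infty$ and $n-k_n\to\infty$ as $n\to\infty$. For each $n$ consider the autoregressive model $y_0=0$, $y_t=\rho_t y_{t-1}+z_t$ $(t\ge 1)$, where $(z_t)_{t\ge1}$ is a white noise process (square integrable, mean zero, pairwise uncorrelated) with variance $1$ and $$\rho_t=\rho+\varepsilon\,\mathbf 1_{[k_n,\,k_n+h-1]}(t),$$ and let $B_n=[\operatorname{var}(y_1,\dots,y_n)]^{-1}\in\mathbb R^{n\times n}$ be the precision matrix of $(y_1,\dots,y_n)$. For real symmetric matrices $A_n\in\mathbb R^{n\times n}$ whose empirical spectral distributions $\frac1n\sum_{i=1}^n\delta_{\lambda_i(A_n)}$ converge weakly to a compactly supported probability measure $\mu$ on $\mathbb R$, a point $x\in\mathbb R$ is called an outlier of $\{A_n\}$ if $x\notin\overline{\operatorname{supp}\mu}$ and $\lim_{n\to\infty}\inf_{y\in\operatorname{spec}(A_n)}|x-y|=0$;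 the set of outliers is denoted $out(\{A_n\})$. Put $a_\rho=(1-|\rho|)^2$, $b_\rho=(1+|\rho|)^2$, and let $f(x)=1+\rho^2-\rho(x+x^{-1})$, a bijection from $(-1,1)\setminus\{0\}$ onto $\mathbb R\setminus[a_\rho,b_\rho]$ with inverse $f^{-1}$. Put $$\alpha(x)=\frac{\rho x^{-1}+\varepsilon(\varepsilon+2\rho)}{\varepsilon+\rho},\qquad \beta(x)=\frac{\rho(x+x^{-1})+\varepsilon(\varepsilon+2\rho)}{\varepsilon+\rho},\qquad \gamma(x)=\frac{\rho x^{-1}}{\varepsilon+\rho},$$ and for $z\notin[a_\rho,b_\rho]$ let $M_{h+1}(z)$ be the symmetric tridiagonal $(h+1)\times(h+1)$ matrix with diagonal entries $\alpha(x),\beta(x),\dots,\beta(x),\gamma(x)$ at $x=f^{-1}(z)$ (with $h-1$ entries $\beta(x)$) and all entries directly above and below the diagonal equal to $-1$. Then the empirical spectral distributions of $B_n$ converge weakly to a compactly supported probability measure (so that $out(\{B_n\})$ is defined), and for every $z\in\mathbb R$ the following are equivalent: (i) $z\in out(\{B_n\})$; (ii) $z\notin[a_\rho,b_\rho]$ and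 $\det M_{h+1}(z)=0$. -/

import Mathlib

open MeasureTheory ProbabilityTheory Filter Topology
open scoped BoundedContinuousFunction

namespace SCM

noncomputable section

/-! ### Spectral distributions and outliers of a sequence of matrices -/

/-- The empirical spectral distribution `(1/n) ∑ᵢ δ_{λᵢ(A)}` of a real symmetric matrix
(eigenvalues counted with multiplicity). -/
def esd {n : ℕ} {A : Matrix (Fin n) (Fin n) ℝ} (hA : A.IsHermitian) : Measure ℝ :=
  (n : ENNReal)⁻¹ • ∑ i, Measure.dirac (hA.eigenvalues i)

/-- `μ` is the asymptotic spectral distribution of the sequence `A` of real symmetric matrices: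
a compactly supported probability measure to which the empirical spectral distributions of
`A n` converge weakly. -/
structure IsASD (A : ∀ n : ℕ, Matrix (Fin n) (Fin n) ℝ) (μ : Measure ℝ) : Prop where
  isProbabilityMeasure : IsProbabilityMeasure μ
  isCompact_support : IsCompact μ.support
  tendsto_esd : ∃ hA : ∀ n, (A n).IsHermitian, ∀ g : ℝ →ᵇ ℝ,
    Tendsto (fun n => ∫ x, g x ∂(esd (hA n))) atTop (𝓝 (∫ x, g x ∂μ))

/-- The set `out({A_n})` of outliers: the points outside the closed support of the asymptotic
spectral distribution whose distance to the spectrum of `A n` tends to zero. -/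
def outliers (A : ∀ n : ℕ, Matrix (Fin n) (Fin n) ℝ) : Set ℝ :=
  {x | ∃ μ : Measure ℝ, IsASD A μ ∧ x ∉ closure μ.support ∧
    Tendsto (fun n => Metric.infDist x (spectrum ℝ (A n))) atTop (𝓝 0)}

/-! ### The autoregressive model with a structural change -/

variable {Ω : Type*} [MeasurableSpace Ω]

/-- `(w_t)_{t ≥ 1}` is a white noise process with unit variance. -/
structure IsWhiteNoise (w : ℕ → Ω → ℝ) (P : Measure Ω) : Prop where
  memLp : ∀ t, 1 ≤ t → MemLp (w t) 2 P
  mean : ∀ t, 1 ≤ t → ∫ ω, w t ω ∂P = 0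
  variance : ∀ t, 1 ≤ t → Var[w t; P] = 1
  uncorrelated : ∀ s t, 1 ≤ s → 1 ≤ t → s ≠ t → cov[w s, w t; P] = 0

/-- The process `y_0 = 0`, `y_t = r_t y_{t-1} + w_t` for `t ≥ 1`. -/
def arProcess (r : ℕ → ℝ) (w : ℕ → Ω → ℝ) : ℕ → Ω → ℝ
  | 0 => fun _ => 0
  | t + 1 => fun ω => r (t + 1) * arProcess r w t ω + w (t + 1) ω

/-- The precision matrix `[var(y_1, …, y_n)]⁻¹` of `(y_1, …, y_n)`. -/
def precisionMatrix (y : ℕ → Ω → ℝ) (P : Measure Ω) (n : ℕ) : Matrix (Fin n) (Fin n) ℝ :=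
  (Matrix.of fun i j : Fin n => cov[y (i.val + 1), y (j.val + 1); P])⁻¹

/-- The coefficients `ρ_t = ρ + ε 1_{[k, k+h-1]}(t)`. -/
def intervalCoeff (ρ ε : ℝ) (h k t : ℕ) : ℝ :=
  ρ + if k ≤ t ∧ t < k + h then ε else 0

/-- The matrices `B_n`: for each `n`, the precision matrix of `(y_1, …, y_n)` for the model with
coefficients `ρ + ε 1_{[k_n, k_n+h-1]}(t)`, where the break point `k_n` may depend on `n`. -/
def intervalPrecision (P : Measure Ω) (w : ℕ → Ω → ℝ) (ρ ε : ℝ) (h : ℕ) (k : ℕ → ℕ) (n : ℕ) :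
    Matrix (Fin n) (Fin n) ℝ :=
  precisionMatrix (arProcess (intervalCoeff ρ ε h (k n)) w) P n

/-! ### The determinantal equation -/

/-- `a_ρ = (1 - |ρ|)²`. -/
def lowerEdge (ρ : ℝ) : ℝ := (1 - |ρ|) ^ 2

/-- `b_ρ = (1 + |ρ|)²`. -/
def upperEdge (ρ : ℝ) : ℝ := (1 + |ρ|) ^ 2

/-- `f(x) = 1 + ρ² - ρ (x + x⁻¹)`. -/
def f (ρ x : ℝ) : ℝ := 1 + ρ ^ 2 - ρ * (x + x⁻¹)

/-- `f` maps `(-1,1) \ {0}` bijectively onto the complement of `[a_ρ, b_ρ]`. -/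
theorem bijOn_f {ρ : ℝ} (hρ0 : ρ ≠ 0) :
    Set.BijOn (f ρ) (Set.Ioo (-1) 1 \ {0}) (Set.Icc (lowerEdge ρ) (upperEdge ρ))ᶜ := by
  have hpos : 0 < |ρ| := abs_pos.mpr hρ0
  refine ⟨?_, ?_, ?_⟩
  · rintro x ⟨⟨h1, h2⟩, h0⟩
    have h0 : x ≠ 0 := h0
    have hsq := sq_abs ρ
    have hx : f ρ x * x = (1 + ρ ^ 2) * x - ρ * (x ^ 2 + 1) := by
      unfold f
      field_simp
    simp only [Set.mem_compl_iff, Set.mem_Icc, lowerEdge, upperEdge]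
    rintro ⟨ha, hb⟩
    have hle : |f ρ x - (1 + ρ ^ 2)| ≤ 2 * |ρ| := by
      rw [abs_le]
      constructor <;> nlinarith
    have h3 : f ρ x - (1 + ρ ^ 2) = -(ρ * (x + x⁻¹)) := by
      unfold f
      ring
    rw [h3, abs_neg, abs_mul, mul_comm 2] at hle
    have h4 : |x + x⁻¹| ≤ 2 := le_of_mul_le_mul_left hle hpos
    have h5 : (x + x⁻¹) ^ 2 ≤ 2 ^ 2 := sq_le_sq' (abs_le.mp h4).1 (abs_le.mp h4).2
    have h6 : (x + x⁻¹) ^ 2 = 4 + (x - x⁻¹) ^ 2 := by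
      field_simp
      ring
    have h7 : x - x⁻¹ = 0 := by
      have : (x - x⁻¹) ^ 2 = 0 := le_antisymm (by linarith) (sq_nonneg _)
      exact pow_eq_zero_iff (two_ne_zero) |>.mp this
    have h8 : x ^ 2 = 1 := by
      field_simp at h7
      linarith
    nlinarith
  · rintro x ⟨⟨h1, h2⟩, h0⟩ y ⟨⟨h3, h4⟩, h5⟩ hxy
    have h0 : x ≠ 0 := h0
    have h5 : y ≠ 0 := h5
    have h6 : x + x⁻¹ = y + y⁻¹ := by
      have : ρ * (x + x⁻¹) = ρ * (y + y⁻¹) := by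
        unfold f at hxy
        linarith
      exact mul_left_cancel₀ hρ0 this
    field_simp at h6
    have h7 : (x - y) * (x * y - 1) = 0 := by linarith
    have h8 : x * y < 1 := by
      have : |x * y| < 1 := by
        rw [abs_mul]
        exact mul_lt_one_of_nonneg_of_lt_one_left (abs_nonneg _) (abs_lt.mpr ⟨h1, h2⟩)
          (abs_lt.mpr ⟨h3, h4⟩).le
      exact (abs_lt.mp this).2
    rcases mul_eq_zero.mp h7 with h | h <;> linarith
  · intro z hz
    simp only [Set.mem_compl_iff, Set.mem_Icc, lowerEdge, upperEdge] at hz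
    obtain ⟨s, hs⟩ : ∃ s, s = (1 + ρ ^ 2 - z) / ρ := ⟨_, rfl⟩
    have hsz : ρ * s = 1 + ρ ^ 2 - z := by
      rw [hs]
      field_simp
    have hsq := sq_abs ρ
    have hs2 : 2 < |s| := by
      by_contra! hc
      have : |ρ * s| ≤ 2 * |ρ| := by
        rw [abs_mul]
        nlinarith
      rw [hsz, abs_le] at this
      exact hz ⟨by nlinarith, by nlinarith⟩
    -- a root of `x² - s x + 1` inside the unit interval
    have hfin : ∀ u : ℝ, 2 < u → ∃ x : ℝ, 0 < x ∧ x < 1 ∧ x + x⁻¹ = u := by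
      intro u hu
      have hd : 0 ≤ u ^ 2 - 4 := by nlinarith
      have hr := Real.sq_sqrt hd
      have hr0 := Real.sqrt_nonneg (u ^ 2 - 4)
      have hlt : √(u ^ 2 - 4) < u := by nlinarith
      have hgt : u - 2 < √(u ^ 2 - 4) := by
        apply Real.lt_sqrt_of_sq_lt
        nlinarith
      refine ⟨(u - √(u ^ 2 - 4)) / 2, by linarith, by linarith, ?_⟩
      have hne : u - √(u ^ 2 - 4) ≠ 0 := by linarith
      field_simp
      nlinarith
    have hf : ∀ x, x + x⁻¹ = s → f ρ x = z := by
      intro x hx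
      unfold f
      rw [hx, hsz]
      ring
    rcases lt_abs.mp hs2 with hpos' | hneg
    · obtain ⟨x, hx0, hx1, hx⟩ := hfin s hpos'
      exact ⟨x, ⟨⟨by linarith, hx1⟩, hx0.ne'⟩, hf x hx⟩
    · obtain ⟨x, hx0, hx1, hx⟩ := hfin (-s) hneg
      refine ⟨-x, ⟨⟨by linarith, by linarith⟩, ?_⟩, hf _ ?_⟩
      · simpa using hx0.ne'
      · rw [inv_neg]
        linarith

/-- The inverse `f⁻¹` of the bijection `f : (-1,1) \ {0} → [a_ρ, b_ρ]ᶜ`. -/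
def fInv (ρ : ℝ) : ℝ → ℝ := Function.invFunOn (f ρ) (Set.Ioo (-1) 1 \ {0})

/-- `α(x) = (ρ x⁻¹ + ε (ε + 2ρ)) / (ε + ρ)`. -/
def α (ρ ε x : ℝ) : ℝ := (ρ * x⁻¹ + ε * (ε + 2 * ρ)) / (ε + ρ)

/-- `β(x) = (ρ (x + x⁻¹) + ε (ε + 2ρ)) / (ε + ρ)`. -/
def β (ρ ε x : ℝ) : ℝ := (ρ * (x + x⁻¹) + ε * (ε + 2 * ρ)) / (ε + ρ)

/-- `γ(x) = ρ x⁻¹ / (ε + ρ)`. -/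
def γ (ρ ε x : ℝ) : ℝ := ρ * x⁻¹ / (ε + ρ)

/-- The tridiagonal matrix `M_{h+1}(z)` with diagonal `α, β, …, β, γ` evaluated at `f⁻¹(z)` and
all entries `-1` next to the diagonal. -/
def M (ρ ε : ℝ) (h : ℕ) (z : ℝ) : Matrix (Fin (h + 1)) (Fin (h + 1)) ℝ :=
  Matrix.of fun i j =>
    if i = j then
      if i = 0 then α ρ ε (fInv ρ z)
      else if i = Fin.last h then γ ρ ε (fInv ρ z)
      else β ρ ε (fInv ρ z)
    else if i.val + 1 = j.val ∨ j.val + 1 = i.val then -1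
    else 0

end

end SCM

namespace SCM

noncomputable section

/-! ### The precision matrix as a product of bidiagonal matrices -/

/-! The model reads `L y = w` with `L` unit lower bidiagonal, so the precision matrix is `LᵀL`
(`precisionMatrix_arProcess`), a tridiagonal matrix. After that no probability remains.

Limiting spectrum. Up to a corner entry and at most `h` subdiagonal entries, `L` is the circulant `1
- ρ S⁻¹`. This perturbation has entrywise mass bounded in `n`, so traces of powers change by `O(1)`,
and after division by `n` all moments converge to those of `1 + ρ² - 2ρ cos θ` with `θ` uniform
(`tendsto_esd_bidiagonalGram`). The law of this variable has support `[a_ρ, b_ρ]`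
(`support_symbolLaw`), so an outlier is a point off this interval that is a limit of eigenvalues.

Outliers. Write `z = f(x)` with `0 < |x| < 1`. Away from the break, the rows of `LᵀL - z` are `ρ ((x
+ x⁻¹) V_t - V_{t-1} - V_{t+1})`, with homogeneous solutions `x^t` and `x^(-t)`; a localized
eigenvector must decay with ratio `x` on both sides of the break. Substituting this decay into the
`h + 1` rows that see the changed coefficients leaves exactly `(ε + ρ) M u = 0`
(`rowOp_intervalCoeff_window`).

If `det M = 0`, a kernel vector continued geometrically satisfies every row except the first and the
last, where the error is exponentially small in the distance to the break. It is an approximate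
eigenvector, so by symmetry an eigenvalue is near `z` (`tendsto_infDist_of_det_eq_zero`).
Conversely, normalize an eigenvector for the eigenvalue nearest to `z` in maximum norm. Since `|x +
x⁻¹| > 2`, its maximum cannot lie in the bulk when the eigenvalue is close to `z`. It therefore lies
in the window, where the vector nearly solves `M u = 0`; this is impossible for invertible `M`
(`eigenvalue_far_or`, `det_eq_zero_of_tendsto_infDist`). -/

/-- The bidiagonal matrix with `1` on the diagonal and `-r_2, …, -r_n` below it. -/
def lowerBidiagonal (r : ℕ → ℝ) (n : ℕ) : Matrix (Fin n) (Fin n) ℝ :=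
  Matrix.of fun i j =>
    (if j = i then 1 else 0) - (if j.val + 1 = i.val then r (i.val + 1) else 0)

theorem sum_lowerBidiagonal_row (r g : ℕ → ℝ) (n : ℕ) (i : Fin n) :
    ∑ j, lowerBidiagonal r n i j * g (j.val + 1) =
      g (i.val + 1) - if i.val = 0 then 0 else r (i.val + 1) * g i.val := by
  obtain ⟨i, hi⟩ := i
  simp only [lowerBidiagonal, Matrix.of_apply, sub_mul, ite_mul, one_mul, zero_mul,
    Finset.sum_sub_distrib, Finset.sum_ite_eq', Finset.mem_univ, if_true]
  congr 1
  rcases Nat.eq_zero_or_pos i with h0 | h0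
  · simp [h0]
  · rw [if_neg h0.ne', Finset.sum_eq_single ⟨i - 1, by omega⟩]
    · have : i - 1 + 1 = i := by omega
      simp [this]
    · intro b _ hb
      rw [if_neg]
      intro hc
      exact hb (Fin.ext (by simp; omega))
    · simp

theorem sum_lowerBidiagonal_col (r g : ℕ → ℝ) (n : ℕ) (i : Fin n) :
    ∑ j, lowerBidiagonal r n j i * g (j.val + 1) =
      g (i.val + 1) - if i.val + 1 = n then 0 else r (i.val + 2) * g (i.val + 2) := by
  obtain ⟨i, hi⟩ := i
  simp only [lowerBidiagonal, Matrix.of_apply, sub_mul, ite_mul, one_mul, zero_mul,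
    Finset.sum_sub_distrib, Finset.sum_ite_eq, Finset.mem_univ, if_true]
  congr 1
  by_cases h0 : i + 1 = n
  · rw [if_pos h0]
    refine Finset.sum_eq_zero fun j _ => if_neg ?_
    have := j.isLt
    simp; omega
  · rw [if_neg h0, Finset.sum_eq_single ⟨i + 1, by omega⟩]
    · simp
    · intro b _ hb
      rw [if_neg]
      intro hc
      exact hb (Fin.ext (by simp at hc ⊢; omega))
    · simp

theorem noise_eq {Ω : Type*} (w : ℕ → Ω → ℝ) (r : ℕ → ℝ) (t : ℕ) :
    w (t + 1) = arProcess r w (t + 1) - r (t + 1) • arProcess r w t := by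
  ext ω
  simp [arProcess]

variable {Ω : Type*} [MeasurableSpace Ω]

theorem memLp_arProcess {w : ℕ → Ω → ℝ} {P : Measure Ω} (hw : IsWhiteNoise w P) (r : ℕ → ℝ) (t : ℕ) :
    MemLp (arProcess r w t) 2 P := by
  induction t with
  | zero => exact MemLp.zero
  | succ t ih => exact (ih.const_mul (r (t + 1))).add (hw.memLp (t + 1) (by omega))

theorem covariance_noise {w : ℕ → Ω → ℝ} {P : Measure Ω} (hw : IsWhiteNoise w P) (s t : ℕ) :
    cov[w (s + 1), w (t + 1); P] = if s = t then 1 else 0 := by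
  split_ifs with h
  · subst h
    rw [covariance_self (hw.memLp _ (by omega)).aestronglyMeasurable.aemeasurable]
    exact hw.variance _ (by omega)
  · exact hw.uncorrelated _ _ (by omega) (by omega) (by omega)

/-- Since `L` maps the observations to the noise, `L S Lᵀ` is the covariance matrix of the noise,
the identity; inverting gives `S⁻¹ = LᵀL`. -/
theorem precisionMatrix_arProcess {w : ℕ → Ω → ℝ} {P : Measure Ω} [IsProbabilityMeasure P]
    (hw : IsWhiteNoise w P) (r : ℕ → ℝ) (n : ℕ) :
    precisionMatrix (arProcess r w) P n =
      (lowerBidiagonal r n).transpose * lowerBidiagonal r n := by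
  set y := arProcess r w
  have hm : ∀ t, MemLp (y t) 2 P := memLp_arProcess hw r
  have h0 : y 0 = 0 := rfl
  unfold precisionMatrix
  set S : Matrix (Fin n) (Fin n) ℝ :=
    Matrix.of fun i j : Fin n => cov[y (i.val + 1), y (j.val + 1); P] with hS
  -- `L S` is the cross-covariance of noise and observations. The first row of `L` has no
  -- subdiagonal entry, which is harmless because `y 0 = 0`.
  have h1 : ∀ i j : Fin n, (lowerBidiagonal r n * S) i j = cov[w (i.val + 1), y (j.val + 1); P] := by
    intro i j
    rw [Matrix.mul_apply]
    simp only [hS, Matrix.of_apply]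
    rw [sum_lowerBidiagonal_row r (fun t => cov[y t, y (j.val + 1); P]), noise_eq w r,
      covariance_sub_left (hm _) ((hm _).const_smul _) (hm _), covariance_smul_left]
    split_ifs with hi
    · rw [hi, h0, covariance_zero_left, mul_zero]
    · rfl
  have h2 : lowerBidiagonal r n * (S * (lowerBidiagonal r n).transpose) = 1 := by
    rw [← Matrix.mul_assoc]
    ext i j
    rw [Matrix.mul_apply]
    simp only [h1, Matrix.transpose_apply]
    simp_rw [mul_comm (cov[_, _; P])]
    rw [sum_lowerBidiagonal_row r (fun t => cov[w (i.val + 1), y t; P])]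
    have h3 : cov[w (i.val + 1), w (j.val + 1); P] = if i = j then 1 else 0 := by
      rw [covariance_noise hw]
      simp [Fin.ext_iff]
    rw [Matrix.one_apply, ← h3]
    conv_rhs => rw [noise_eq w r j.val]
    rw [covariance_sub_right (hw.memLp _ (by omega)) (hm _) ((hm _).const_smul _),
      covariance_smul_right]
    split_ifs with hj
    · rw [hj, h0, covariance_zero_right, mul_zero]
    · rfl
  rw [mul_eq_one_comm, Matrix.mul_assoc] at h2
  exact Matrix.inv_eq_right_inv h2

/-- The matrix `Lᵀ L`, with `L` the bidiagonal matrix of the coefficients `r`. -/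
def bidiagonalGram (r : ℕ → ℝ) (n : ℕ) : Matrix (Fin n) (Fin n) ℝ :=
  (lowerBidiagonal r n).transpose * lowerBidiagonal r n

theorem isHermitian_bidiagonalGram (r : ℕ → ℝ) (n : ℕ) : (bidiagonalGram r n).IsHermitian := by
  simpa [bidiagonalGram] using Matrix.isHermitian_conjTranspose_mul_self (lowerBidiagonal r n)

/-- The action of `Lᵀ L` on a vector `(V_1, …, V_n)` as a second order difference operator, with
correction terms at both ends. -/
theorem bidiagonalGram_mulVec (r V : ℕ → ℝ) (n : ℕ) (i : Fin n) :
    (bidiagonalGram r n).mulVec (fun j => V (j.val + 1)) i =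
      (1 + r (i.val + 2) ^ 2) * V (i.val + 1) - r (i.val + 1) * V i.val
        - r (i.val + 2) * V (i.val + 2)
        + (if i.val = 0 then r 1 * V 0 else 0)
        + (if i.val + 1 = n then r (n + 1) * (V (n + 1) - r (n + 1) * V n) else 0) := by
  -- `W` is `L V` as a sequence; the case `t = 1` reflects that `L` does not contain `r 1`.
  set W : ℕ → ℝ := fun t => V t - if t = 1 then 0 else r t * V (t - 1) with hW
  have h1 : (lowerBidiagonal r n).mulVec (fun j => V (j.val + 1)) = fun j => W (j.val + 1) := by
    ext j
    rw [Matrix.mulVec, dotProduct, sum_lowerBidiagonal_row]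
    simp [hW]
  rw [bidiagonalGram, ← Matrix.mulVec_mulVec, h1, Matrix.mulVec, dotProduct]
  simp only [Matrix.transpose_apply]
  rw [sum_lowerBidiagonal_col]
  simp only [hW]
  by_cases h0 : i.val = 0 <;> by_cases h2 : i.val + 1 = n
  · simp only [h0, ← h2]; norm_num; ring
  · simp only [h0]; rw [h0] at h2; simp [h2]; ring
  · simp only [h0, ← h2]; norm_num [h0]; ring
  · simp [h0, h2]; ring

/-! ### Traces of powers and bounded row sums -/

/-- All absolute row sums of `A` are at most `K`. -/
def RowSumLe {n : ℕ} (K : ℝ) (A : Matrix (Fin n) (Fin n) ℝ) : Prop :=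
  ∀ i, ∑ j, |A i j| ≤ K

theorem RowSumLe.abs_apply_le {n : ℕ} {K : ℝ} {A : Matrix (Fin n) (Fin n) ℝ} (hA : RowSumLe K A)
    (i j : Fin n) : |A i j| ≤ K :=
  (Finset.single_le_sum (f := fun j => |A i j|) (fun _ _ => abs_nonneg _)
    (Finset.mem_univ j)).trans (hA i)

theorem RowSumLe.mul {n : ℕ} {K K' : ℝ} {A A' : Matrix (Fin n) (Fin n) ℝ} (hA : RowSumLe K A)
    (hA' : RowSumLe K' A') (hK' : 0 ≤ K') : RowSumLe (K * K') (A * A') := by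
  intro i
  calc ∑ j, |(A * A') i j| ≤ ∑ j, ∑ l, |A i l| * |A' l j| := by
        gcongr with j
        rw [Matrix.mul_apply]
        simp_rw [← abs_mul]
        exact Finset.abs_sum_le_sum_abs _ _
    _ = ∑ l, |A i l| * ∑ j, |A' l j| := by
        rw [Finset.sum_comm]
        simp_rw [Finset.mul_sum]
    _ ≤ ∑ l, |A i l| * K' := by
        gcongr with l
        exact hA' l
    _ = (∑ l, |A i l|) * K' := by rw [Finset.sum_mul]
    _ ≤ K * K' := by
        gcongr
        exact hA i

theorem RowSumLe.pow {n : ℕ} {K : ℝ} {A : Matrix (Fin n) (Fin n) ℝ} (hA : RowSumLe K A)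
    (hK : 0 ≤ K) (m : ℕ) : RowSumLe (K ^ m) (A ^ m) := by
  induction m with
  | zero =>
    intro i
    simp [Matrix.one_apply, apply_ite abs]
  | succ m ih =>
    rw [pow_succ, pow_succ]
    exact ih.mul hA hK

theorem RowSumLe.one {n : ℕ} : RowSumLe 1 (1 : Matrix (Fin n) (Fin n) ℝ) := by
  intro i
  simp [Matrix.one_apply, apply_ite abs]

/-- Entries of `X` are at most `K`, so only the total entrywise mass of `E` matters. For
perturbations of bounded mass this is a bound free of `n`. -/
theorem RowSumLe.abs_trace_mul_le {n : ℕ} {K : ℝ} {X : Matrix (Fin n) (Fin n) ℝ}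
    (hX : RowSumLe K X) (E : Matrix (Fin n) (Fin n) ℝ) :
    |(X * E).trace| ≤ K * ∑ i, ∑ j, |E i j| := by
  rw [Matrix.trace_mul_comm]
  simp only [Matrix.trace, Matrix.diag, Matrix.mul_apply, Finset.mul_sum]
  refine (Finset.abs_sum_le_sum_abs _ _).trans (Finset.sum_le_sum fun i _ => ?_)
  refine (Finset.abs_sum_le_sum_abs _ _).trans (Finset.sum_le_sum fun j _ => ?_)
  rw [abs_mul, mul_comm]
  exact mul_le_mul_of_nonneg_right (hX.abs_apply_le _ _) (abs_nonneg _)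

/-- If `tr (X (A - C))` is bounded in terms of the row sums of `X`, so is `tr (X (Aᵐ - Cᵐ))`. -/
theorem abs_trace_mul_pow_sub_le {n : ℕ} {K K₁ : ℝ} (hK : 0 ≤ K)
    {A C : Matrix (Fin n) (Fin n) ℝ} (hA : RowSumLe K A) (hC : RowSumLe K C)
    (hAC : ∀ (κ : ℝ) (X : Matrix (Fin n) (Fin n) ℝ), 0 ≤ κ → RowSumLe κ X →
      |(X * (A - C)).trace| ≤ κ * K₁) (m : ℕ) :
    ∀ (κ : ℝ) (X : Matrix (Fin n) (Fin n) ℝ), 0 ≤ κ → RowSumLe κ X →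
      |(X * (A ^ m - C ^ m)).trace| ≤ κ * (m * K ^ (m - 1) * K₁) := by
  induction m with
  | zero => intro κ X _ _; simp
  | succ m ih =>
    intro κ X hκ hX
    -- Telescoping: `A^(m+1) - C^(m+1) = A^m (A - C) + (A^m - C^m) C`; cyclicity of the trace moves
    -- the last `C` in front of `X`, which is why the induction runs over all `X`.
    have h1 : (X * (A ^ (m + 1) - C ^ (m + 1))).trace =
        (X * A ^ m * (A - C)).trace + (C * X * (A ^ m - C ^ m)).trace := by
      rw [Matrix.mul_assoc C, Matrix.trace_mul_comm C, ← Matrix.trace_add]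
      congr 1
      rw [pow_succ, pow_succ]
      noncomm_ring
    have h2 := hAC _ _ (by positivity) (hX.mul (hA.pow hK m) (by positivity))
    have h3 := ih _ _ (by positivity) (hC.mul hX hκ)
    rw [h1]
    refine (abs_add_le _ _).trans ((add_le_add h2 h3).trans (le_of_eq ?_))
    rcases m with _ | m
    · simp
    · simp only [Nat.add_sub_cancel]
      push_cast
      ring

/-- Read the eigenvalue equation at a coordinate where the eigenvector has maximal modulus. -/
theorem abs_eigenvalues_le {n : ℕ} {K : ℝ} {A : Matrix (Fin n) (Fin n) ℝ} (hA : A.IsHermitian)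
    (hK : RowSumLe K A) (l : Fin n) : |hA.eigenvalues l| ≤ K := by
  set v : Fin n → ℝ := ⇑(hA.eigenvectorBasis l) with hv
  have hne : Nonempty (Fin n) := ⟨l⟩
  have hAv : A.mulVec v = hA.eigenvalues l • v := hA.mulVec_eigenvectorBasis l
  obtain ⟨i, hi⟩ := Finite.exists_max fun i => |v i|
  have hpos : 0 < |v i| := by
    by_contra! hc
    have h0 : hA.eigenvectorBasis l = 0 := by
      ext j
      exact abs_nonpos_iff.mp ((hi j).trans hc)
    have := hA.eigenvectorBasis.orthonormal.1 l
    rw [h0, norm_zero] at this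
    exact zero_ne_one this
  refine le_of_mul_le_mul_right ?_ hpos
  rw [← abs_mul, ← smul_eq_mul, ← Pi.smul_apply, ← hAv, Matrix.mulVec, dotProduct]
  calc |∑ j, A i j * v j| ≤ ∑ j, |A i j| * |v i| := by
        refine (Finset.abs_sum_le_sum_abs _ _).trans (Finset.sum_le_sum fun j _ => ?_)
        rw [abs_mul]
        exact mul_le_mul_of_nonneg_left (hi j) (abs_nonneg _)
    _ ≤ K * |v i| := by
        rw [← Finset.sum_mul]
        exact mul_le_mul_of_nonneg_right (hK i) hpos.le

theorem trace_pow_eq_sum_eigenvalues {n : ℕ} {A : Matrix (Fin n) (Fin n) ℝ} (hA : A.IsHermitian)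
    (m : ℕ) : (A ^ m).trace = ∑ i, hA.eigenvalues i ^ m := by
  conv_lhs => rw [hA.spectral_theorem]
  rw [← map_pow, Unitary.conjStarAlgAut_apply, Matrix.trace_mul_cycle, Unitary.coe_star_mul_self,
    one_mul, Matrix.diagonal_pow, Matrix.trace_diagonal]
  simp

/-! ### The method of moments for empirical spectral distributions -/

theorem integral_esd {n : ℕ} {A : Matrix (Fin n) (Fin n) ℝ} (hA : A.IsHermitian) (g : ℝ → ℝ) : ∫ x, g x ∂(esd hA) = (n : ℝ)⁻¹ * ∑ i, g (hA.eigenvalues i) := by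
  rw [esd, integral_smul_measure, integral_finsetSum_measure]
  · simp [integral_dirac]
  · intro i _
    exact integrable_dirac (by simp)

/-- All spectra and the limit law live in `[-R, R]`, so Weierstrass approximation reduces continuous
test functions to polynomials, that is, to traces of powers. -/
theorem tendsto_esd_of_tendsto_moments {A : ∀ n : ℕ, Matrix (Fin n) (Fin n) ℝ}
    (hA : ∀ n, (A n).IsHermitian) {μ : Measure ℝ} [IsProbabilityMeasure μ] {R : ℝ}
    (hR : ∀ n i, |(hA n).eigenvalues i| ≤ R) (hμ : ∀ᵐ x ∂μ, |x| ≤ R)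
    (hmom : ∀ m : ℕ, Tendsto (fun n : ℕ => (n : ℝ)⁻¹ * (A n ^ m).trace) atTop (𝓝 (∫ x, x ^ m ∂μ)))
    (g : ℝ →ᵇ ℝ) :
    Tendsto (fun n => ∫ x, g x ∂(esd (hA n))) atTop (𝓝 (∫ x, g x ∂μ)) := by
  have hint : ∀ q : ℝ → ℝ, Continuous q → Integrable q μ := by
    intro q hq
    obtain ⟨c, hc⟩ := (isCompact_Icc (a := -R) (b := R)).exists_bound_of_continuousOn
      hq.continuousOn
    refine Integrable.of_bound hq.aestronglyMeasurable c ?_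
    filter_upwards [hμ] with x hx
    exact hc x (abs_le.mp hx)
  have hpoly : ∀ p : Polynomial ℝ, Tendsto (fun n => ∫ x, p.eval x ∂(esd (hA n))) atTop
      (𝓝 (∫ x, p.eval x ∂μ)) := by
    intro p
    simp_rw [fun n => integral_esd (hA n), Polynomial.eval_eq_sum_range]
    rw [integral_finsetSum _ fun i _ => (hint _ (by fun_prop))]
    simp_rw [Finset.sum_comm (s := Finset.univ), Finset.mul_sum _ _ (_ : ℝ)⁻¹]
    refine tendsto_finsetSum _ fun m _ => ?_
    rw [integral_const_mul]
    refine ((hmom m).const_mul (p.coeff m)).congr fun n => ?_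
    rw [trace_pow_eq_sum_eigenvalues (hA n)]
    simp_rw [Finset.mul_sum]
    exact Finset.sum_congr rfl fun i _ => by ring
  rw [Metric.tendsto_atTop]
  intro e he
  obtain ⟨p, hp⟩ := exists_polynomial_near_of_continuousOn (-R) R g g.continuous.continuousOn
    (e / 3) (by positivity)
  obtain ⟨N, hN⟩ := Metric.tendsto_atTop.mp (hpoly p) (e / 3) (by positivity)
  have h1 : |∫ x, p.eval x ∂μ - ∫ x, g x ∂μ| ≤ e / 3 := by
    rw [← integral_sub (hint _ p.continuous) (hint _ g.continuous)]
    have := norm_integral_le_of_norm_le_const (μ := μ) (f := fun x => p.eval x - g x) (C := e / 3)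
      (by
        filter_upwards [hμ] with x hx
        exact (hp x (abs_le.mp hx)).le)
    simpa using this
  have h2 : ∀ n, |∫ x, p.eval x ∂(esd (hA n)) - ∫ x, g x ∂(esd (hA n))| ≤ e / 3 := by
    intro n
    rw [integral_esd (hA n), integral_esd (hA n), ← mul_sub,
      ← Finset.sum_sub_distrib, abs_mul, abs_of_nonneg (by positivity)]
    have h3 : |∑ i, (p.eval ((hA n).eigenvalues i) - g ((hA n).eigenvalues i))| ≤ n * (e / 3) := by
      refine (Finset.abs_sum_le_sum_abs _ _).trans ?_
      refine (Finset.sum_le_card_nsmul _ _ (e / 3) fun i _ =>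
        (hp _ (abs_le.mp (hR n i))).le).trans ?_
      simp
    rcases Nat.eq_zero_or_pos n with h0 | h0
    · subst h0
      simp
      positivity
    · have : (0 : ℝ) < n := by exact_mod_cast h0
      rw [inv_mul_le_iff₀ this]
      exact h3
  refine ⟨N, fun n hn => ?_⟩
  have h4 := hN n hn
  have h5 := h2 n
  rw [Real.dist_eq] at h4 ⊢
  rw [abs_le] at h1 h5
  rw [abs_lt] at h4 ⊢
  constructor <;> linarith

/-! ### The limiting spectral distribution -/

/-- The symbol `1 + ρ² - 2ρ cos θ`. -/
def symbol (ρ θ : ℝ) : ℝ := 1 + ρ ^ 2 - 2 * ρ * Real.cos θ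

theorem continuous_symbol (ρ : ℝ) : Continuous (symbol ρ) := by
  unfold symbol
  fun_prop

theorem symbol_mem_Icc (ρ θ : ℝ) : symbol ρ θ ∈ Set.Icc (lowerEdge ρ) (upperEdge ρ) := by
  have h1 : |ρ * Real.cos θ| ≤ |ρ| := by
    rw [abs_mul]
    exact mul_le_of_le_one_right (abs_nonneg _) (Real.abs_cos_le_one θ)
  have h2 := sq_abs ρ
  rw [abs_le] at h1
  unfold symbol lowerEdge upperEdge
  constructor <;> nlinarith

theorem exists_symbol_eq {ρ z : ℝ} (hρ0 : ρ ≠ 0) (hz : z ∈ Set.Icc (lowerEdge ρ) (upperEdge ρ)) :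
    ∃ θ ∈ Set.Icc 0 Real.pi, symbol ρ θ = z := by
  have hpos : 0 < |ρ| := abs_pos.mpr hρ0
  have h2 := sq_abs ρ
  unfold lowerEdge upperEdge at hz
  have h3 : |(1 + ρ ^ 2 - z) / (2 * ρ)| ≤ 1 := by
    rw [abs_div, div_le_one (by positivity), abs_mul, abs_two, abs_le]
    constructor <;> nlinarith [hz.1, hz.2]
  rw [abs_le] at h3
  refine ⟨Real.arccos ((1 + ρ ^ 2 - z) / (2 * ρ)), ⟨Real.arccos_nonneg _, Real.arccos_le_pi _⟩, ?_⟩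
  rw [symbol, Real.cos_arccos h3.1 h3.2]
  field_simp
  ring

/-- The distribution of `1 + ρ² - 2ρ cos θ` for `θ` uniform on the circle. -/
def symbolLaw (ρ : ℝ) : Measure ℝ :=
  (ENNReal.ofReal (2 * Real.pi)⁻¹ • volume.restrict (Set.Ioc 0 (2 * Real.pi))).map (symbol ρ)

theorem integral_symbolLaw (ρ : ℝ) {g : ℝ → ℝ} (hg : Continuous g) :
    ∫ x, g x ∂(symbolLaw ρ) = (2 * Real.pi)⁻¹ * ∫ θ in 0..(2 * Real.pi), g (symbol ρ θ) := by
  have := Real.pi_pos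
  rw [symbolLaw, integral_map (continuous_symbol ρ).aemeasurable hg.aestronglyMeasurable,
    integral_smul_measure, intervalIntegral.integral_of_le (by positivity),
    ENNReal.toReal_ofReal (by positivity), smul_eq_mul]

instance isProbabilityMeasure_symbolLaw (ρ : ℝ) : IsProbabilityMeasure (symbolLaw ρ) := by
  have := Real.pi_pos
  refine Measure.isProbabilityMeasure_map_iff (continuous_symbol ρ).aemeasurable |>.mpr ⟨?_⟩
  rw [Measure.smul_apply, Measure.restrict_apply_univ, Real.volume_Ioc, smul_eq_mul,
    ← ENNReal.ofReal_mul (by positivity), sub_zero, inv_mul_cancel₀ (by positivity),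
    ENNReal.ofReal_one]

/-- The symbol is continuous with range `[a_ρ, b_ρ]`: a neighbourhood of a value pulls back to a set
of angles containing a nonempty open set, which has positive length. -/
theorem support_symbolLaw {ρ : ℝ} (hρ0 : ρ ≠ 0) :
    (symbolLaw ρ).support = Set.Icc (lowerEdge ρ) (upperEdge ρ) := by
  have hpi := Real.pi_pos
  have hmeas := (continuous_symbol ρ).measurable
  refine Set.Subset.antisymm ?_ ?_
  · refine Measure.support_subset_of_isClosed isClosed_Icc ?_
    rw [symbolLaw]
    exact (ae_map_iff hmeas.aemeasurable measurableSet_Icc).mpr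
      (Eventually.of_forall fun θ => symbol_mem_Icc ρ θ)
  · intro z hz
    rw [Measure.mem_support_iff_forall]
    intro U hU
    obtain ⟨V, hVU, hV, hzV⟩ := mem_nhds_iff.mp hU
    refine lt_of_lt_of_le ?_ (measure_mono hVU)
    obtain ⟨θ, hθ, hθz⟩ := exists_symbol_eq hρ0 hz
    rw [symbolLaw, Measure.map_apply hmeas hV.measurableSet, Measure.smul_apply, smul_eq_mul]
    refine ENNReal.mul_pos (by simp; positivity) ?_
    rw [Measure.restrict_apply (hmeas hV.measurableSet)]
    have hW : IsOpen (symbol ρ ⁻¹' V) := hV.preimage (continuous_symbol ρ)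
    -- The angle found may be the endpoint `0`, so it is only placed in the closure and then moved
    -- into the open interval.
    have hθW : θ ∈ closure (Set.Ioo 0 (2 * Real.pi)) := by
      rw [closure_Ioo (by positivity)]
      exact ⟨hθ.1, by linarith [hθ.2]⟩
    have hne : (symbol ρ ⁻¹' V ∩ Set.Ioo 0 (2 * Real.pi)).Nonempty :=
      mem_closure_iff.mp hθW _ hW (by simpa [hθz] using hzV)
    have hpos := (hW.inter isOpen_Ioo).measure_pos volume hne
    exact (hpos.trans_le
      (measure_mono (Set.inter_subset_inter_right _ Set.Ioo_subset_Ioc_self))).ne'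

/-! ### The circulant comparison matrix -/

open Equiv.Perm in
/-- The circulant matrix `(1 + ρ²) - ρ (S + S⁻¹)`, where `S` is the cyclic shift. -/
def circulantGram (ρ : ℝ) (n : ℕ) : Matrix (Fin n) (Fin n) ℝ :=
  (1 + ρ ^ 2) • (1 : Matrix (Fin n) (Fin n) ℝ)
    - ρ • (permMatrix ℝ (finRotate n) + permMatrix ℝ (finRotate n)⁻¹)

/-- The rotation is an `n`-cycle: a power of it with a fixed point is the identity, so `n` would
divide the nonzero number `|j| < n`. -/
theorem finRotate_zpow_apply_ne {n : ℕ} {j : ℤ} (hj : j ≠ 0) (hn : j.natAbs + 2 ≤ n) (x : Fin n) :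
    ((finRotate n) ^ j) x ≠ x := by
  have hcyc := isCycle_finRotate_of_le (n := n) (by omega)
  have hsupp := support_finRotate_of_le (n := n) (by omega)
  have hord : orderOf (finRotate n) = n := by
    rw [hcyc.orderOf, hsupp, Finset.card_univ, Fintype.card_fin]
  intro hx
  have hx' : ((finRotate n) ^ j.natAbs) x = x := by
    rcases Int.natAbs_eq j with h | h
    · rw [h, zpow_natCast] at hx
      exact hx
    · rw [h, zpow_neg, zpow_natCast, Equiv.Perm.inv_eq_iff_eq] at hx
      exact hx.symm
  have h1 : (finRotate n) ^ j.natAbs = 1 := by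
    rw [hcyc.pow_eq_one_iff]
    refine ⟨x, ?_, hx'⟩
    rw [← Equiv.Perm.mem_support, hsupp]
    exact Finset.mem_univ x
  have h2 := Nat.le_of_dvd (by omega) (orderOf_dvd_of_pow_eq_one h1)
  omega

theorem intervalIntegral_cos_int_mul {j : ℤ} (hj : j ≠ 0) :
    ∫ θ in (0 : ℝ)..(2 * Real.pi), Real.cos (j * θ) = 0 := by
  have hj' : (j : ℝ) ≠ 0 := by exact_mod_cast hj
  rw [intervalIntegral.integral_comp_mul_left _ hj', integral_cos, mul_zero, Real.sin_zero,
    show (j : ℝ) * (2 * Real.pi) = ((2 * j : ℤ) : ℝ) * Real.pi by push_cast; ring,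
    Real.sin_int_mul_pi, sub_zero, smul_zero]

/-- Carrying a shift `j` makes the induction on `m` close: one circulant factor splits into the
shifts `j` and `j ± 1`, and `2 cos θ cos jθ = cos (j+1)θ + cos (j-1)θ` gives the integrals the same
recursion. For `m = 0`, both sides are `1` if `j = 0` and vanish in the limit otherwise. -/
theorem tendsto_trace_circulantGram_pow_mul (ρ : ℝ) (m : ℕ) : ∀ j : ℤ,
    Tendsto (fun n : ℕ => (n : ℝ)⁻¹ *
        (circulantGram ρ n ^ m * Equiv.Perm.permMatrix ℝ ((finRotate n) ^ j)).trace) atTop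
      (𝓝 ((2 * Real.pi)⁻¹ * ∫ θ in 0..(2 * Real.pi), symbol ρ θ ^ m * Real.cos (j * θ))) := by
  have hpi := Real.pi_pos
  induction m with
  | zero =>
    intro j
    refine tendsto_const_nhds.congr' ?_
    filter_upwards [eventually_ge_atTop (j.natAbs + 2)] with n hn
    simp only [pow_zero, one_mul]
    rw [Matrix.trace_permutation]
    rcases eq_or_ne j 0 with h0 | h0
    · subst h0
      have hn0 : (n : ℝ) ≠ 0 := by
        have : n ≠ 0 := by omega
        exact_mod_cast this
      have : Function.fixedPoints (((finRotate n) ^ (0 : ℤ) : Equiv.Perm (Fin n))) = Set.univ := by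
        ext x
        simp
      rw [this]
      simp [Set.ncard_univ, hn0]
      field_simp
    · have : Function.fixedPoints (((finRotate n) ^ j : Equiv.Perm (Fin n))) = ∅ := by
        ext x
        simpa [Function.mem_fixedPoints, Function.IsFixedPt] using finRotate_zpow_apply_ne h0 hn x
      rw [this, intervalIntegral_cos_int_mul h0]
      simp
  | succ m ih =>
    intro j
    have hc := continuous_symbol ρ
    have h1 : ∀ n : ℕ, (n : ℝ)⁻¹ *
        (circulantGram ρ n ^ (m + 1) * Equiv.Perm.permMatrix ℝ ((finRotate n) ^ j)).trace =
        (1 + ρ ^ 2) * ((n : ℝ)⁻¹ *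
          (circulantGram ρ n ^ m * Equiv.Perm.permMatrix ℝ ((finRotate n) ^ j)).trace)
        - ρ * ((n : ℝ)⁻¹ *
          (circulantGram ρ n ^ m * Equiv.Perm.permMatrix ℝ ((finRotate n) ^ (j + 1))).trace)
        - ρ * ((n : ℝ)⁻¹ *
          (circulantGram ρ n ^ m * Equiv.Perm.permMatrix ℝ ((finRotate n) ^ (j - 1))).trace) := by
      intro n
      have h2 : circulantGram ρ n * Equiv.Perm.permMatrix ℝ ((finRotate n) ^ j) =
          (1 + ρ ^ 2) • Equiv.Perm.permMatrix ℝ ((finRotate n) ^ j)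
          - ρ • Equiv.Perm.permMatrix ℝ ((finRotate n) ^ (j + 1))
          - ρ • Equiv.Perm.permMatrix ℝ ((finRotate n) ^ (j - 1)) := by
        rw [zpow_add_one, zpow_sub_one, Matrix.permMatrix_mul, Matrix.permMatrix_mul, circulantGram,
          sub_mul, smul_mul_assoc, smul_mul_assoc, one_mul, add_mul, smul_add, sub_sub]
      rw [pow_succ, Matrix.mul_assoc, h2, Matrix.mul_sub, Matrix.mul_sub, Matrix.mul_smul,
        Matrix.mul_smul, Matrix.mul_smul, Matrix.trace_sub, Matrix.trace_sub, Matrix.trace_smul,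
        Matrix.trace_smul, Matrix.trace_smul, smul_eq_mul, smul_eq_mul, smul_eq_mul]
      ring
    have h3 : (2 * Real.pi)⁻¹ * ∫ θ in 0..(2 * Real.pi), symbol ρ θ ^ (m + 1) * Real.cos (j * θ) =
        (1 + ρ ^ 2) * ((2 * Real.pi)⁻¹ *
          ∫ θ in 0..(2 * Real.pi), symbol ρ θ ^ m * Real.cos (j * θ))
        - ρ * ((2 * Real.pi)⁻¹ *
          ∫ θ in 0..(2 * Real.pi), symbol ρ θ ^ m * Real.cos ((j + 1 : ℤ) * θ))
        - ρ * ((2 * Real.pi)⁻¹ *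
          ∫ θ in 0..(2 * Real.pi), symbol ρ θ ^ m * Real.cos ((j - 1 : ℤ) * θ)) := by
      have hint : ∀ l : ℤ, IntervalIntegrable (fun θ => symbol ρ θ ^ m * Real.cos (l * θ)) volume
          0 (2 * Real.pi) := fun l => Continuous.intervalIntegrable (by fun_prop) _ _
      have h4 : ∀ θ : ℝ, symbol ρ θ ^ (m + 1) * Real.cos (j * θ) =
          (1 + ρ ^ 2) * (symbol ρ θ ^ m * Real.cos (j * θ))
          - ρ * (symbol ρ θ ^ m * Real.cos ((j + 1 : ℤ) * θ))
          - ρ * (symbol ρ θ ^ m * Real.cos ((j - 1 : ℤ) * θ)) := by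
        intro θ
        have h5 : Real.cos ((j + 1 : ℤ) * θ) + Real.cos ((j - 1 : ℤ) * θ) =
            2 * Real.cos θ * Real.cos (j * θ) := by
          push_cast
          rw [add_mul, sub_mul, one_mul, Real.cos_add, Real.cos_sub]
          ring
        have h6 : ρ * (symbol ρ θ ^ m * Real.cos ((j + 1 : ℤ) * θ))
            + ρ * (symbol ρ θ ^ m * Real.cos ((j - 1 : ℤ) * θ)) =
            ρ * symbol ρ θ ^ m * (2 * Real.cos θ * Real.cos (j * θ)) := by
          rw [← h5]
          ring
        rw [sub_sub, h6, pow_succ]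
        conv_lhs => rw [symbol.eq_1 ρ θ]
        unfold symbol
        ring
      simp_rw [h4]
      rw [intervalIntegral.integral_sub (((hint j).const_mul _).sub ((hint _).const_mul _))
        ((hint _).const_mul _), intervalIntegral.integral_sub ((hint j).const_mul _)
        ((hint _).const_mul _)]
      simp only [intervalIntegral.integral_const_mul]
      ring
    rw [h3]
    simp_rw [h1]
    exact (((ih j).const_mul _).sub ((ih (j + 1)).const_mul _)).sub ((ih (j - 1)).const_mul _)

theorem tendsto_trace_circulantGram_pow (ρ : ℝ) (m : ℕ) :
    Tendsto (fun n : ℕ => (n : ℝ)⁻¹ * (circulantGram ρ n ^ m).trace) atTop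
      (𝓝 (∫ x, x ^ m ∂(symbolLaw ρ))) := by
  rw [integral_symbolLaw ρ (continuous_pow m)]
  simpa using tendsto_trace_circulantGram_pow_mul ρ m 0

/-- The cyclic analogue of `lowerBidiagonal` with constant coefficient `ρ`. -/
def cyclicBidiagonal (ρ : ℝ) (n : ℕ) : Matrix (Fin n) (Fin n) ℝ :=
  1 - ρ • Equiv.Perm.permMatrix ℝ (finRotate n)⁻¹

theorem cyclicBidiagonal_transpose_mul_self (ρ : ℝ) (n : ℕ) :
    (cyclicBidiagonal ρ n).transpose * cyclicBidiagonal ρ n = circulantGram ρ n := by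
  have h1 : Equiv.Perm.permMatrix ℝ (finRotate n) * Equiv.Perm.permMatrix ℝ (finRotate n)⁻¹ = 1 := by
    rw [← Matrix.permMatrix_mul, inv_mul_cancel, Matrix.permMatrix_one]
  rw [cyclicBidiagonal, Matrix.transpose_sub, Matrix.transpose_one, Matrix.transpose_smul,
    Matrix.transpose_permMatrix, inv_inv, circulantGram, sub_mul, mul_sub, mul_sub, one_mul,
    mul_one, one_mul, smul_mul_smul_comm, h1, smul_add, add_smul, one_smul, sq]
  abel

/-! ### Comparison of the bidiagonal and the circulant model -/

theorem sum_ite_succ_eq_le {n : ℕ} (i : Fin n) {c : ℝ} (hc : 0 ≤ c) :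
    ∑ j : Fin n, (if j.val + 1 = i.val then c else 0) ≤ c := by
  rw [Finset.sum_ite, Finset.sum_const_zero, add_zero, Finset.sum_const, nsmul_eq_mul]
  refine mul_le_of_le_one_left hc ?_
  exact_mod_cast Finset.card_le_one.mpr fun a ha b hb => by
    simp only [Finset.mem_filter] at ha hb
    exact Fin.ext (by omega)

theorem sum_ite_eq_succ_le {n : ℕ} (i : Fin n) {c : ℝ} (hc : 0 ≤ c) :
    ∑ j : Fin n, (if i.val + 1 = j.val then c else 0) ≤ c := by
  rw [Finset.sum_ite, Finset.sum_const_zero, add_zero, Finset.sum_const, nsmul_eq_mul]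
  refine mul_le_of_le_one_left hc ?_
  exact_mod_cast Finset.card_le_one.mpr fun a ha b hb => by
    simp only [Finset.mem_filter] at ha hb
    exact Fin.ext (by omega)

theorem abs_lowerBidiagonal_le {r : ℕ → ℝ} {c : ℝ} (hr : ∀ t, |r t| ≤ c) {n : ℕ} (i j : Fin n) :
    |lowerBidiagonal r n i j| ≤
      (if j = i then 1 else 0) + (if j.val + 1 = i.val then c else 0) := by
  refine (abs_sub _ _).trans (add_le_add ?_ ?_)
  · split_ifs <;> simp
  · split_ifs
    · exact hr _
    · simp

theorem rowSumLe_lowerBidiagonal {r : ℕ → ℝ} {c : ℝ} (hr : ∀ t, |r t| ≤ c) (n : ℕ) :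
    RowSumLe (1 + c) (lowerBidiagonal r n) := by
  intro i
  refine (Finset.sum_le_sum fun j _ => abs_lowerBidiagonal_le hr i j).trans ?_
  rw [Finset.sum_add_distrib]
  refine add_le_add (by simp) (sum_ite_succ_eq_le i ((abs_nonneg _).trans (hr 0)))

theorem rowSumLe_lowerBidiagonal_transpose {r : ℕ → ℝ} {c : ℝ} (hr : ∀ t, |r t| ≤ c) (n : ℕ) :
    RowSumLe (1 + c) (lowerBidiagonal r n).transpose := by
  intro i
  refine (Finset.sum_le_sum fun j _ => abs_lowerBidiagonal_le hr j i).trans ?_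
  rw [Finset.sum_add_distrib]
  refine add_le_add (by simp) (sum_ite_eq_succ_le i ((abs_nonneg _).trans (hr 0)))

theorem permMatrix_apply {n : ℕ} (σ : Equiv.Perm (Fin n)) (i j : Fin n) :
    Equiv.Perm.permMatrix ℝ σ i j = if σ i = j then 1 else 0 := by
  simp [Equiv.Perm.permMatrix, PEquiv.toMatrix_apply, Equiv.toPEquiv, eq_comm]

theorem rowSumLe_one_sub_permMatrix (ρ : ℝ) {n : ℕ} (σ : Equiv.Perm (Fin n)) :
    RowSumLe (1 + |ρ|) (1 - ρ • Equiv.Perm.permMatrix ℝ σ) := by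
  intro i
  calc ∑ j, |(1 - ρ • Equiv.Perm.permMatrix ℝ σ : Matrix (Fin n) (Fin n) ℝ) i j|
      ≤ ∑ j, ((if i = j then 1 else 0) + (if σ i = j then |ρ| else 0)) := by
        refine Finset.sum_le_sum fun j _ => ?_
        rw [Matrix.sub_apply, Matrix.smul_apply, permMatrix_apply, Matrix.one_apply]
        refine (abs_sub _ _).trans (add_le_add ?_ ?_) <;> split_ifs <;> simp
    _ = 1 + |ρ| := by simp [Finset.sum_add_distrib]

theorem cyclicBidiagonal_transpose (ρ : ℝ) (n : ℕ) :
    (cyclicBidiagonal ρ n).transpose = 1 - ρ • Equiv.Perm.permMatrix ℝ (finRotate n) := by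
  rw [cyclicBidiagonal, Matrix.transpose_sub, Matrix.transpose_one, Matrix.transpose_smul,
    Matrix.transpose_permMatrix, inv_inv]

theorem finRotate_inv_eq_iff {n : ℕ} {i j : Fin n} (hi : i.val ≠ 0) :
    (finRotate n)⁻¹ i = j ↔ j.val + 1 = i.val := by
  rw [Equiv.Perm.inv_eq_iff_eq]
  obtain ⟨m, rfl⟩ : ∃ m, n = m + 1 := ⟨n - 1, by have := i.isLt; omega⟩
  rcases Nat.lt_or_ge j.val m with h | h
  · have : j = ⟨j.val, by omega⟩ := rfl
    rw [this, finRotate_of_lt h, Fin.ext_iff]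
    simp [eq_comm]
  · have : j = Fin.last m := Fin.ext (by have := j.isLt; simp; omega)
    rw [this, finRotate_last, Fin.ext_iff]
    have := i.isLt
    simp only [Fin.val_last, Fin.val_zero]
    omega

/-- The two matrices differ only in the wrap-around entry of the first row, of size `|ρ|`, and on
the subdiagonal by `r - ρ`. -/
theorem sum_sum_abs_lowerBidiagonal_sub_le (r : ℕ → ℝ) (ρ : ℝ) (n : ℕ) :
    ∑ i, ∑ j, |(lowerBidiagonal r n - cyclicBidiagonal ρ n) i j| ≤
      |ρ| + ∑ i ∈ Finset.range n, |r (i + 1) - ρ| := by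
  have hE : ∀ i j, (lowerBidiagonal r n - cyclicBidiagonal ρ n) i j =
      (if (finRotate n)⁻¹ i = j then ρ else 0)
        - (if j.val + 1 = i.val then r (i.val + 1) else 0) := by
    intro i j
    rw [Matrix.sub_apply, cyclicBidiagonal, Matrix.sub_apply, Matrix.smul_apply, permMatrix_apply,
      Matrix.one_apply, lowerBidiagonal, Matrix.of_apply]
    simp only [eq_comm (a := j) (b := i), smul_eq_mul, mul_ite, mul_one, mul_zero]
    ring
  have hrow : ∀ i : Fin n, ∑ j, |(lowerBidiagonal r n - cyclicBidiagonal ρ n) i j| ≤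
      (if i.val = 0 then |ρ| else 0) + |r (i.val + 1) - ρ| := by
    intro i
    simp_rw [hE]
    split_ifs with hi
    · have h1 : ∀ j : Fin n, ¬ (j.val + 1 = i.val) := by omega
      simp [h1, apply_ite abs]
    · simp only [finRotate_inv_eq_iff hi, zero_add]
      refine le_trans (le_of_eq ?_) (sum_ite_succ_eq_le i (abs_nonneg (r (i.val + 1) - ρ)))
      refine Finset.sum_congr rfl fun j _ => ?_
      split_ifs
      · exact abs_sub_comm _ _
      · simp
  refine (Finset.sum_le_sum fun i _ => hrow i).trans ?_
  rw [Finset.sum_add_distrib, Fin.sum_univ_eq_sum_range (fun i => |r (i + 1) - ρ|) n,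
    Fin.sum_univ_eq_sum_range (fun i => if i = 0 then |ρ| else 0) n]
  refine add_le_add ?_ le_rfl
  rw [Finset.sum_ite_eq']
  split_ifs
  · exact le_rfl
  · exact abs_nonneg _

/-- If the coefficients are uniformly bounded and differ from `ρ` by a summable amount that is
bounded in `n`, then the empirical spectral distributions of `LᵀL` converge to `symbolLaw ρ`. -/
theorem tendsto_esd_bidiagonalGram {r : ℕ → ℕ → ℝ} {ρ c e : ℝ} (hρ : |ρ| ≤ c)
    (hr : ∀ n t, |r n t| ≤ c) (he : ∀ n, ∑ i ∈ Finset.range n, |r n (i + 1) - ρ| ≤ e)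
    (g : ℝ →ᵇ ℝ) :
    Tendsto (fun n => ∫ x, g x ∂(esd (isHermitian_bidiagonalGram (r n) n))) atTop
      (𝓝 (∫ x, g x ∂(symbolLaw ρ))) := by
  have hc : 0 ≤ c := (abs_nonneg _).trans hρ
  have hL := fun n => rowSumLe_lowerBidiagonal (hr n) n
  have hLt := fun n => rowSumLe_lowerBidiagonal_transpose (hr n) n
  have hmono : ∀ {n : ℕ} {X : Matrix (Fin n) (Fin n) ℝ}, RowSumLe (1 + |ρ|) X →
      RowSumLe (1 + c) X := fun hX i => (hX i).trans (by linarith)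
  have hC : ∀ n, RowSumLe (1 + c) (cyclicBidiagonal ρ n) := fun n =>
    hmono (rowSumLe_one_sub_permMatrix ρ _)
  have hCt : ∀ n, RowSumLe (1 + c) (cyclicBidiagonal ρ n).transpose := fun n => by
    rw [cyclicBidiagonal_transpose]
    exact hmono (rowSumLe_one_sub_permMatrix ρ _)
  have hB : ∀ n, RowSumLe ((1 + c) * (1 + c)) (bidiagonalGram (r n) n) := fun n =>
    (hLt n).mul (hL n) (by positivity)
  have hG : ∀ n, RowSumLe ((1 + c) * (1 + c)) (circulantGram ρ n) := fun n => by
    rw [← cyclicBidiagonal_transpose_mul_self]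
    exact (hCt n).mul (hC n) (by positivity)
  have hE : ∀ n, ∑ i, ∑ j, |(lowerBidiagonal (r n) n - cyclicBidiagonal ρ n) i j| ≤ c + e :=
    fun n => (sum_sum_abs_lowerBidiagonal_sub_le (r n) ρ n).trans (add_le_add hρ (he n))
  have hdiff : ∀ n (κ : ℝ) (X : Matrix (Fin n) (Fin n) ℝ), 0 ≤ κ → RowSumLe κ X →
      |(X * (bidiagonalGram (r n) n - circulantGram ρ n)).trace| ≤
        κ * (2 * (1 + c) * (c + e)) := by
    intro n κ X hκ hX
    set L := lowerBidiagonal (r n) n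
    set C := cyclicBidiagonal ρ n
    -- From `LᵀL - CᵀC = (L - C)ᵀ L + Cᵀ (L - C)` and cyclicity of the trace.
    have h1 : (X * (bidiagonalGram (r n) n - circulantGram ρ n)).trace =
        (L * X * (L - C).transpose).trace + (X * C.transpose * (L - C)).trace := by
      rw [Matrix.mul_assoc L, Matrix.trace_mul_comm L, ← Matrix.trace_add, bidiagonalGram,
        ← cyclicBidiagonal_transpose_mul_self, Matrix.transpose_sub]
      congr 1
      noncomm_ring
    have h2 := ((hL n).mul hX hκ).abs_trace_mul_le (L - C).transpose
    have h3 := (hX.mul (hCt n) (by positivity)).abs_trace_mul_le (L - C)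
    simp only [Matrix.transpose_apply] at h2
    rw [Finset.sum_comm] at h2
    rw [h1]
    refine (abs_add_le _ _).trans ((add_le_add h2 h3).trans ?_)
    have h4 : (1 + c) * κ * ∑ i, ∑ j, |(L - C) i j| ≤ (1 + c) * κ * (c + e) :=
      mul_le_mul_of_nonneg_left (hE n) (by positivity)
    nlinarith
  refine tendsto_esd_of_tendsto_moments (R := (1 + c) * (1 + c)) _
    (fun n i => abs_eigenvalues_le _ (hB n) i) ?_ (fun m => ?_) g
  · rw [symbolLaw]
    refine (ae_map_iff (continuous_symbol ρ).aemeasurable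
      (measurableSet_le measurable_norm measurable_const)).mpr (Eventually.of_forall fun θ => ?_)
    obtain ⟨h1, h2⟩ := symbol_mem_Icc ρ θ
    unfold lowerEdge upperEdge at *
    have h3 := abs_nonneg ρ
    rw [Real.norm_eq_abs, abs_le]
    constructor <;> nlinarith [sq_nonneg (1 - |ρ|)]
  · have hpow := fun n => abs_trace_mul_pow_sub_le (by positivity) (hB n) (hG n) (hdiff n) m 1 1
      zero_le_one RowSumLe.one
    set D := 1 * (m * ((1 + c) * (1 + c)) ^ (m - 1) * (2 * (1 + c) * (c + e)))
    have hzero : Tendsto (fun n : ℕ => (n : ℝ)⁻¹ *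
        (bidiagonalGram (r n) n ^ m - circulantGram ρ n ^ m).trace) atTop (𝓝 0) := by
      have hD : Tendsto (fun n : ℕ => (n : ℝ)⁻¹ * D) atTop (𝓝 0) := by
        simpa using (tendsto_inv_atTop_nhds_zero_nat (𝕜 := ℝ)).mul_const D
      refine squeeze_zero_norm (fun n => ?_) hD
      rw [norm_mul, norm_inv, Real.norm_natCast]
      have := hpow n
      rw [one_mul] at this
      exact mul_le_mul_of_nonneg_left this (by positivity)
    have := hzero.add (tendsto_trace_circulantGram_pow ρ m)
    rw [zero_add] at this
    refine this.congr fun n => ?_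
    rw [Matrix.trace_sub]
    ring

theorem abs_intervalCoeff_le (ρ ε : ℝ) (h k t : ℕ) : |intervalCoeff ρ ε h k t| ≤ |ρ| + |ε| := by
  refine (abs_add_le _ _).trans (add_le_add le_rfl ?_)
  split_ifs <;> simp

theorem sum_abs_intervalCoeff_sub_le (ρ ε : ℝ) (h k n : ℕ) :
    ∑ i ∈ Finset.range n, |intervalCoeff ρ ε h k (i + 1) - ρ| ≤ h * |ε| := by
  simp only [intervalCoeff, add_sub_cancel_left, apply_ite abs, abs_zero]
  rw [Finset.sum_ite, Finset.sum_const_zero, add_zero, Finset.sum_const, nsmul_eq_mul]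
  refine mul_le_mul_of_nonneg_right ?_ (abs_nonneg _)
  have h1 : (Finset.range n).filter (fun i => k ≤ i + 1 ∧ i + 1 < k + h) ⊆
      (Finset.Ico k (k + h)).image (fun t => t - 1) := by
    intro i hi
    simp only [Finset.mem_filter] at hi
    exact Finset.mem_image.mpr ⟨i + 1, Finset.mem_Ico.mpr hi.2, rfl⟩
  have h2 := (Finset.card_le_card h1).trans Finset.card_image_le
  rw [Nat.card_Ico] at h2
  exact_mod_cast (by omega : _ ≤ h)

theorem isASD_bidiagonalGram {ρ : ℝ} (hρ0 : ρ ≠ 0) (ε : ℝ) (h : ℕ) (k : ℕ → ℕ) :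
    IsASD (fun n => bidiagonalGram (intervalCoeff ρ ε h (k n)) n) (symbolLaw ρ) where
  isProbabilityMeasure := inferInstance
  isCompact_support := by
    rw [support_symbolLaw hρ0]
    exact isCompact_Icc
  tendsto_esd := ⟨fun n => isHermitian_bidiagonalGram _ n,
    tendsto_esd_bidiagonalGram (le_add_of_nonneg_right (abs_nonneg ε))
      (fun n t => abs_intervalCoeff_le ρ ε h (k n) t)
      (fun n => sum_abs_intervalCoeff_sub_le ρ ε h (k n) n)⟩

/-- `outliers` quantifies existentially over the limit law; uniqueness identifies that law with
`symbolLaw ρ`. -/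
theorem IsASD.unique {A : ∀ n : ℕ, Matrix (Fin n) (Fin n) ℝ} {μ ν : Measure ℝ} (hμ : IsASD A μ)
    (hν : IsASD A ν) : μ = ν := by
  have := hμ.isProbabilityMeasure
  have := hν.isProbabilityMeasure
  obtain ⟨_, h1⟩ := hμ.tendsto_esd
  obtain ⟨_, h2⟩ := hν.tendsto_esd
  exact ext_of_forall_integral_eq_of_IsFiniteMeasure fun g => tendsto_nhds_unique (h1 g) (h2 g)

/-! ### Eigenvalues and approximate eigenvectors -/

/-- A symmetric matrix has an eigenvalue close to `z` if it has an approximate eigenvector. -/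
theorem infDist_sq_mul_le {n : ℕ} {A : Matrix (Fin n) (Fin n) ℝ} (hA : A.IsHermitian) (z : ℝ)
    (v : Fin n → ℝ) :
    Metric.infDist z (spectrum ℝ A) ^ 2 * ∑ i, v i ^ 2 ≤ ∑ i, (A.mulVec v i - z * v i) ^ 2 := by
  set b := hA.eigenvectorBasis
  have hnorm : ∀ u : Fin n → ℝ, ∑ i, u i ^ 2 = ∑ l, (u ⬝ᵥ ⇑(b l)) ^ 2 := by
    intro u
    have h1 := b.sum_sq_norm_inner_right (WithLp.toLp 2 u)
    rw [EuclideanSpace.norm_sq_eq] at h1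
    simp only [Real.norm_eq_abs, sq_abs] at h1
    rw [← h1]
    refine Finset.sum_congr rfl fun l _ => ?_
    rw [EuclideanSpace.inner_eq_star_dotProduct]
    simp
  have hAsymm : ∀ u u' : Fin n → ℝ, A.mulVec u ⬝ᵥ u' = u ⬝ᵥ A.mulVec u' := by
    intro u u'
    rw [dotProduct_comm, Matrix.dotProduct_mulVec, dotProduct_comm, ← Matrix.mulVec_transpose]
    congr 2
  rw [hnorm v, hnorm (fun i => A.mulVec v i - z * v i), Finset.mul_sum]
  refine Finset.sum_le_sum fun l _ => ?_
  -- In the orthonormal eigenbasis `A - z` multiplies each coordinate by `λ_l - z`, whose modulus is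
  -- at least the distance from `z` to the spectrum.
  have h2 : (fun i => A.mulVec v i - z * v i) ⬝ᵥ ⇑(b l) =
      (hA.eigenvalues l - z) * (v ⬝ᵥ ⇑(b l)) := by
    have h3 : (fun i => A.mulVec v i - z * v i) = A.mulVec v - z • v := rfl
    rw [h3, sub_dotProduct, hAsymm, hA.mulVec_eigenvectorBasis, smul_dotProduct, dotProduct_smul,
      smul_eq_mul, smul_eq_mul]
    ring
  rw [h2, mul_pow]
  refine mul_le_mul_of_nonneg_right ?_ (sq_nonneg _)
  have h4 := Metric.infDist_le_dist_of_mem (x := z) (hA.eigenvalues_mem_spectrum_real l)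
  rw [dist_comm, Real.dist_eq] at h4
  rw [← sq_abs (_ - z)]
  exact pow_le_pow_left₀ Metric.infDist_nonneg h4 2

/-- An eigenvalue at minimal distance of `z`, with an eigenvector of maximum norm `1`. -/
theorem exists_nearest_eigenvector {n : ℕ} (hn : 0 < n) {A : Matrix (Fin n) (Fin n) ℝ}
    (hA : A.IsHermitian) (z : ℝ) :
    ∃ (l : ℝ) (v : Fin n → ℝ), |l - z| = Metric.infDist z (spectrum ℝ A) ∧
      A.mulVec v = l • v ∧ (∀ i, |v i| ≤ 1) ∧ ∃ i, |v i| = 1 := by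
  have hne : Nonempty (Fin n) := ⟨⟨0, hn⟩⟩
  obtain ⟨l, hl, hd⟩ := (Matrix.finite_real_spectrum (A := A)).isCompact.exists_infDist_eq_dist
    ⟨_, hA.eigenvalues_mem_spectrum_real ⟨0, hn⟩⟩ z
  rw [hA.spectrum_real_eq_range_eigenvalues] at hl
  obtain ⟨j, rfl⟩ := hl
  set v : Fin n → ℝ := ⇑(hA.eigenvectorBasis j)
  obtain ⟨i, hi⟩ := Finite.exists_max fun i => |v i|
  have hpos : 0 < |v i| := by
    by_contra! hc
    have h0 : hA.eigenvectorBasis j = 0 := by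
      ext j
      exact abs_nonpos_iff.mp ((hi j).trans hc)
    have := hA.eigenvectorBasis.orthonormal.1 j
    rw [h0, norm_zero] at this
    exact zero_ne_one this
  refine ⟨hA.eigenvalues j, |v i|⁻¹ • v, ?_, ?_, fun m => ?_, i, ?_⟩
  · rw [hd, dist_comm, Real.dist_eq]
  · rw [Matrix.mulVec_smul, smul_comm, hA.mulVec_eigenvectorBasis]
  · rw [Pi.smul_apply, smul_eq_mul, abs_mul, abs_inv, abs_abs, inv_mul_le_one₀ hpos]
    exact hi m
  · rw [Pi.smul_apply, smul_eq_mul, abs_mul, abs_inv, abs_abs, inv_mul_cancel₀ hpos.ne']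

/-- The eigenvalue equation of `LᵀL` as a second order recursion with boundary conditions. -/
theorem exists_nearest_eigensequence (r : ℕ → ℝ) {n : ℕ} (hn : 0 < n) (z : ℝ) :
    ∃ (l : ℝ) (V : ℕ → ℝ), |l - z| = Metric.infDist z (spectrum ℝ (bidiagonalGram r n)) ∧
      V 0 = 0 ∧ V (n + 1) = r (n + 1) * V n ∧ (∀ t ≤ n, |V t| ≤ 1) ∧
      (∃ t, 1 ≤ t ∧ t ≤ n ∧ |V t| = 1) ∧
      ∀ t, 1 ≤ t → t ≤ n →
        (1 + r (t + 1) ^ 2) * V t - r t * V (t - 1) - r (t + 1) * V (t + 1) = l * V t := by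
  obtain ⟨l, v, hd, hv, hle, i, hi⟩ :=
    exists_nearest_eigenvector hn (isHermitian_bidiagonalGram r n) z
  -- The ghost values `V 0 = 0` and `V (n+1) = r (n+1) V n` are chosen so that both boundary
  -- corrections of `bidiagonalGram_mulVec` vanish.
  set V : ℕ → ℝ := fun t =>
    if h : 1 ≤ t ∧ t ≤ n then v ⟨t - 1, by omega⟩
    else if t = 0 then 0 else r (n + 1) * v ⟨n - 1, by omega⟩ with hV
  have hVv : ∀ j : Fin n, V (j.val + 1) = v j := by
    intro j
    have := j.isLt
    simp only [hV]
    rw [dif_pos (by omega)]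
    rfl
  have hV0 : V 0 = 0 := by simp [hV]
  have hVn : V (n + 1) = r (n + 1) * V n := by
    have h1 : V n = v ⟨n - 1, by omega⟩ := by
      simp only [hV]
      rw [dif_pos (by omega)]
    rw [h1]
    simp [hV]
  refine ⟨l, V, hd, hV0, hVn, ?_, ⟨i.val + 1, by omega, i.isLt, by rw [hVv, hi]⟩, ?_⟩
  · intro t ht
    rcases Nat.eq_zero_or_pos t with h0 | h0
    · rw [h0, hV0]
      simp
    · have := hVv ⟨t - 1, by omega⟩
      simp only [Nat.sub_add_cancel h0] at this
      rw [this]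
      exact hle _
  · intro t h1 h2
    have h3 := bidiagonalGram_mulVec r V n ⟨t - 1, by omega⟩
    have h4 : (fun j : Fin n => V (j.val + 1)) = v := funext hVv
    rw [h4, hv, Pi.smul_apply, smul_eq_mul, ← hVv, hV0, hVn, sub_self, mul_zero, mul_zero, ite_self,
      ite_self] at h3
    obtain ⟨t, rfl⟩ := Nat.exists_eq_add_of_le' h1
    simp only [Nat.add_sub_cancel] at h3 ⊢
    linarith

/-! ### The rows of the shifted matrix -/

theorem sum_tridiagonal (d g : ℕ → ℝ) (h : ℕ) (i : Fin (h + 1)) :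
    ∑ j : Fin (h + 1), (if i = j then d i.val
      else if i.val + 1 = j.val ∨ j.val + 1 = i.val then -1 else 0) * g j.val =
      d i.val * g i.val - (if i.val = 0 then 0 else g (i.val - 1))
        - (if i.val = h then 0 else g (i.val + 1)) := by
  obtain ⟨i, hi⟩ := i
  have h1 : ∀ j : Fin (h + 1), (if (⟨i, hi⟩ : Fin (h + 1)) = j then d i
      else if i + 1 = j.val ∨ j.val + 1 = i then -1 else 0) * g j.val =
      (if j.val = i then d i * g i else 0)
        - (if j.val + 1 = i then g (i - 1) else 0) - (if j.val = i + 1 then g (i + 1) else 0) := by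
    intro j
    rcases lt_trichotomy j.val i with hj | hj | hj
    · by_cases h2 : j.val + 1 = i
      · have : j.val = i - 1 := by omega
        simp [Fin.ext_iff, hj.ne, hj.ne', h2, show j.val ≠ i + 1 by omega, ← this]
      · simp [Fin.ext_iff, hj.ne, hj.ne', h2, show j.val ≠ i + 1 by omega,
          show i + 1 ≠ j.val by omega]
    · simp [Fin.ext_iff, hj]
    · by_cases h2 : j.val = i + 1
      · simp [Fin.ext_iff, h2, show i + 1 + 1 ≠ i by omega]
      · simp [Fin.ext_iff, hj.ne, hj.ne', h2, show j.val + 1 ≠ i by omega,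
          show i + 1 ≠ j.val by omega]
  simp only [h1, Finset.sum_sub_distrib]
  rw [Fin.sum_univ_eq_sum_range (fun j => if j = i then d i * g i else 0),
    Fin.sum_univ_eq_sum_range (fun j => if j + 1 = i then g (i - 1) else 0),
    Fin.sum_univ_eq_sum_range (fun j => if j = i + 1 then g (i + 1) else 0),
    Finset.sum_ite_eq', Finset.sum_ite_eq', if_pos (Finset.mem_range.mpr hi)]
  congr 1
  · congr 1
    rcases i with _ | i
    · simp
    · simp only [Nat.add_right_cancel_iff, Finset.sum_ite_eq']
      rw [if_pos (Finset.mem_range.mpr (by omega)), if_neg (by omega)]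
  · simp only [Finset.mem_range]
    split_ifs <;> first | rfl | omega

theorem M_mulVec (ρ ε : ℝ) (h : ℕ) (z : ℝ) (U : ℕ → ℝ) (i : Fin (h + 1)) :
    (M ρ ε h z).mulVec (fun j => U j.val) i =
      (if i.val = 0 then α ρ ε (fInv ρ z) else if i.val = h then γ ρ ε (fInv ρ z)
        else β ρ ε (fInv ρ z)) * U i.val
        - (if i.val = 0 then 0 else U (i.val - 1)) - (if i.val = h then 0 else U (i.val + 1)) := by
  rw [← sum_tridiagonal (fun i => if i = 0 then α ρ ε (fInv ρ z)
    else if i = h then γ ρ ε (fInv ρ z) else β ρ ε (fInv ρ z)) U h i, Matrix.mulVec, dotProduct]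
  refine Finset.sum_congr rfl fun j _ => ?_
  simp only [M, Matrix.of_apply, Fin.ext_iff, Fin.val_zero, Fin.val_last]

/-- The rows of `LᵀL - z` as a difference operator on sequences. -/
def rowOp (r : ℕ → ℝ) (z : ℝ) (V : ℕ → ℝ) (t : ℕ) : ℝ :=
  (1 + r (t + 1) ^ 2 - z) * V t - r t * V (t - 1) - r (t + 1) * V (t + 1)

theorem fInv_mem {ρ z : ℝ} (hρ0 : ρ ≠ 0) (hz : z ∉ Set.Icc (lowerEdge ρ) (upperEdge ρ)) :
    fInv ρ z ∈ Set.Ioo (-1 : ℝ) 1 \ {0} :=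
  Function.invFunOn_mem ((bijOn_f hρ0).surjOn hz)

theorem f_fInv {ρ z : ℝ} (hρ0 : ρ ≠ 0) (hz : z ∉ Set.Icc (lowerEdge ρ) (upperEdge ρ)) :
    f ρ (fInv ρ z) = z :=
  Function.invFunOn_eq ((bijOn_f hρ0).surjOn hz)

/-- Row `t` involves `r t` and `r (t+1)`, so a break at `K + 1` already affects row `K`; the
affected rows are `K, …, K + h`. -/
theorem rowOp_intervalCoeff_bulk {ρ ε x z : ℝ} {h K : ℕ} (hz : f ρ x = z) (V : ℕ → ℝ) {t : ℕ}
    (ht : t < K ∨ K + h < t) :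
    rowOp (intervalCoeff ρ ε h (K + 1)) z V t =
      ρ * ((x + x⁻¹) * V t - V (t - 1) - V (t + 1)) := by
  rw [rowOp, intervalCoeff, intervalCoeff, if_neg (by omega), if_neg (by omega), ← hz, f]
  ring

/-- Replacing the outer neighbours `V (K-1)` and `V (K+h+1)` by `x V K` and `x V (K+h)` removes `ρ
x` from the corner diagonal entries, turning `x + x⁻¹` into `x⁻¹`. This produces `α` and `γ`; the
subtracted terms measure the failure of geometric decay. -/
theorem rowOp_intervalCoeff_window {ρ ε z : ℝ} {h K : ℕ} (hh : 1 ≤ h) (hερ : ε + ρ ≠ 0)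
    (hz : f ρ (fInv ρ z) = z) (V : ℕ → ℝ) (i : Fin (h + 1)) :
    rowOp (intervalCoeff ρ ε h (K + 1)) z V (K + i.val) =
      (ε + ρ) * (M ρ ε h z).mulVec (fun j => V (K + j.val)) i
        - (if i.val = 0 then ρ * (V (K - 1) - fInv ρ z * V K) else 0)
        - (if i.val = h then ρ * (V (K + h + 1) - fInv ρ z * V (K + h)) else 0) := by
  rw [M_mulVec ρ ε h z (fun j => V (K + j)), rowOp, intervalCoeff, intervalCoeff]
  set x := fInv ρ z
  have hi := i.isLt
  have hα : (ε + ρ) * α ρ ε x = ρ * x⁻¹ + ε * (ε + 2 * ρ) := by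
    rw [α]; field_simp
  have hβ : (ε + ρ) * β ρ ε x = ρ * (x + x⁻¹) + ε * (ε + 2 * ρ) := by
    rw [β]; field_simp
  have hγ : (ε + ρ) * γ ρ ε x = ρ * x⁻¹ := by
    rw [γ]; field_simp
  rw [← hz, f]
  by_cases h0 : i.val = 0
  · rw [if_pos h0, if_pos h0, if_pos h0,
      if_pos (show K + 1 ≤ K + i.val + 1 ∧ K + i.val + 1 < K + 1 + h by omega),
      if_neg (show ¬(K + 1 ≤ K + i.val ∧ K + i.val < K + 1 + h) by omega),
      if_neg (show ¬(i.val = h) by omega), if_neg (show ¬(i.val = h) by omega), h0]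
    simp only [add_zero, zero_add]
    linear_combination -(V K) * hα
  · rw [if_neg h0, if_neg h0, if_neg h0]
    have h2 : K + i.val - 1 = K + (i.val - 1) := by omega
    rw [h2, if_pos (show K + 1 ≤ K + i.val ∧ K + i.val < K + 1 + h by omega)]
    by_cases h3 : i.val = h
    · rw [if_pos h3, if_pos h3, if_pos h3,
        if_neg (show ¬(K + 1 ≤ K + i.val + 1 ∧ K + i.val + 1 < K + 1 + h) by omega), h3]
      linear_combination -(V (K + h)) * hγ
    · rw [if_neg h3, if_neg h3, if_neg h3,
        if_pos (show K + 1 ≤ K + i.val + 1 ∧ K + i.val + 1 < K + 1 + h by omega)]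
      simp only [← add_assoc]
      linear_combination -(V (K + i.val)) * hβ

/-! ### Roots of the determinant are limits of eigenvalues -/

/-- A vector on the window `[K, K + h]`, continued geometrically with ratio `x` on both sides. -/
def geometricExtension (x : ℝ) (h K : ℕ) (u : ℕ → ℝ) (t : ℕ) : ℝ :=
  if t < K then x ^ (K - t) * u 0 else if t ≤ K + h then u (t - K) else x ^ (t - (K + h)) * u h

theorem geometricExtension_left {x : ℝ} {h K : ℕ} {u : ℕ → ℝ} {t : ℕ} (ht : t ≤ K) :
    geometricExtension x h K u t = x ^ (K - t) * u 0 := by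
  rcases ht.lt_or_eq with h1 | h1
  · rw [geometricExtension, if_pos h1]
  · subst h1
    simp [geometricExtension]

theorem geometricExtension_window {x : ℝ} {h K : ℕ} {u : ℕ → ℝ} {j : ℕ} (hj : j ≤ h) :
    geometricExtension x h K u (K + j) = u j := by
  rw [geometricExtension, if_neg (by omega), if_pos (by omega), Nat.add_sub_cancel_left]

theorem geometricExtension_right {x : ℝ} {h K : ℕ} {u : ℕ → ℝ} {t : ℕ} (ht : K + h ≤ t) :
    geometricExtension x h K u t = x ^ (t - (K + h)) * u h := by
  rcases ht.lt_or_eq with h1 | h1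
  · rw [geometricExtension, if_neg (by omega), if_neg (by omega)]
  · subst h1
    simp [geometricExtension]

/-- Powers of `x` solve the bulk recursion, the kernel vector solves the window rows, and ratio `x`
at both edges kills the decay defects. -/
theorem rowOp_geometricExtension {ρ ε z : ℝ} {h K : ℕ} (hh : 1 ≤ h) (hερ : ε + ρ ≠ 0)
    (hx0 : fInv ρ z ≠ 0) (hz : f ρ (fInv ρ z) = z) {u : ℕ → ℝ}
    (hu : (M ρ ε h z).mulVec (fun j => u j.val) = 0) (hK : 1 ≤ K) {t : ℕ} (ht : 1 ≤ t) :
    rowOp (intervalCoeff ρ ε h (K + 1)) z (geometricExtension (fInv ρ z) h K u) t = 0 := by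
  set x := fInv ρ z with hx
  set V := geometricExtension x h K u with hV
  have hpow : ∀ (c : ℝ) (m : ℕ),
      (x + x⁻¹) * (x ^ (m + 1) * c) - x ^ (m + 2) * c - x ^ m * c = 0 := by
    intro c m
    field_simp
    ring
  rcases lt_or_ge t K with h1 | h1
  · rw [rowOp_intervalCoeff_bulk hz V (Or.inl h1), hV, geometricExtension_left (by omega),
      geometricExtension_left (by omega), geometricExtension_left (by omega)]
    have h2 := hpow (u 0) (K - (t + 1))
    rw [show K - (t + 1) + 1 = K - t by omega, show K - (t + 1) + 2 = K - (t - 1) by omega] at h2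
    rw [h2, mul_zero]
  · rcases lt_or_ge (K + h) t with h3 | h3
    · rw [rowOp_intervalCoeff_bulk hz V (Or.inr h3), hV, geometricExtension_right (by omega),
        geometricExtension_right (by omega), geometricExtension_right (by omega)]
      have h2 := hpow (u h) (t - 1 - (K + h))
      rw [show t - 1 - (K + h) + 1 = t - (K + h) by omega,
        show t - 1 - (K + h) + 2 = t + 1 - (K + h) by omega] at h2
      rw [sub_right_comm, h2, mul_zero]
    · obtain ⟨j, rfl⟩ := Nat.exists_eq_add_of_le h1
      have h4 := rowOp_intervalCoeff_window (K := K) hh hερ hz V ⟨j, by omega⟩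
      have h5 : (fun j : Fin (h + 1) => V (K + j.val)) = fun j => u j.val :=
        funext fun j => geometricExtension_window (by have := j.isLt; omega)
      have h6 : V (K - 1) - x * V K = 0 := by
        rw [hV, geometricExtension_left (by omega), geometricExtension_left le_rfl,
          show K - (K - 1) = 1 by omega]
        simp
      have h7 : V (K + h + 1) - x * V (K + h) = 0 := by
        rw [hV, geometricExtension_right (by omega), geometricExtension_right le_rfl,
          show K + h + 1 - (K + h) = 1 by omega]
        simp
      rw [h5, hu, ← hx, h6, h7] at h4
      simpa using h4

/-- The geometric extension, truncated to `1, …, n`, fails the eigenvalue equation only in the first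
and last rows, by `a` and `b`; its norm is at least `|u j|`. -/
theorem infDist_sq_mul_le_of_mulVec_eq_zero {ρ ε z : ℝ} {h K : ℕ} (hh : 1 ≤ h) (hερ : ε + ρ ≠ 0)
    (hx0 : fInv ρ z ≠ 0) (hz : f ρ (fInv ρ z) = z) {u : ℕ → ℝ}
    (hu : (M ρ ε h z).mulVec (fun j => u j.val) = 0) (hK : 1 ≤ K) {n : ℕ} (hn : K + h < n)
    {j : ℕ} (hj : j ≤ h) :
    Metric.infDist z (spectrum ℝ (bidiagonalGram (intervalCoeff ρ ε h (K + 1)) n)) ^ 2 * u j ^ 2 ≤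
      2 * (ρ * (fInv ρ z ^ K * u 0)) ^ 2
        + 2 * (ρ * ((fInv ρ z - ρ) * (fInv ρ z ^ (n - (K + h)) * u h))) ^ 2 := by
  set r := intervalCoeff ρ ε h (K + 1) with hr
  set x := fInv ρ z with hx
  set V := geometricExtension x h K u with hV
  set a := ρ * (x ^ K * u 0)
  set b := ρ * ((x - ρ) * (x ^ (n - (K + h)) * u h))
  have hr1 : r 1 = ρ := by rw [hr, intervalCoeff, if_neg (by omega), add_zero]
  have hrn : r (n + 1) = ρ := by rw [hr, intervalCoeff, if_neg (by omega), add_zero]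
  have hV0 : r 1 * V 0 = a := by rw [hr1, hV, geometricExtension_left (by omega), Nat.sub_zero]
  have hVn : r (n + 1) * (V (n + 1) - r (n + 1) * V n) = b := by
    rw [hrn, hV, geometricExtension_right (by omega), geometricExtension_right (by omega),
      show n + 1 - (K + h) = n - (K + h) + 1 by omega, pow_succ]
    ring
  have hres : ∀ i : Fin n, (bidiagonalGram r n).mulVec (fun j => V (j.val + 1)) i
      - z * V (i.val + 1) = (if i.val = 0 then a else 0) + (if i.val + 1 = n then b else 0) := by
    intro i
    have h1 := rowOp_geometricExtension hh hερ hx0 hz hu hK (t := i.val + 1) (by omega)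
    rw [← hr, ← hx, ← hV, rowOp, Nat.add_sub_cancel] at h1
    rw [bidiagonalGram_mulVec, hV0, hVn]
    linarith
  have h2 := infDist_sq_mul_le (isHermitian_bidiagonalGram r n) z (fun i => V (i.val + 1))
  simp only [hres] at h2
  have h3 : u j ^ 2 ≤ ∑ i : Fin n, V (i.val + 1) ^ 2 := by
    have h4 : V ((⟨K + j - 1, by omega⟩ : Fin n).val + 1) = u j := by
      rw [show (⟨K + j - 1, by omega⟩ : Fin n).val + 1 = K + j by simp; omega, hV,
        geometricExtension_window hj]
    rw [← h4]
    exact Finset.single_le_sum (f := fun i : Fin n => V (i.val + 1) ^ 2)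
      (fun i _ => sq_nonneg _) (Finset.mem_univ _)
  have h5 : ∑ i : Fin n, ((if i.val = 0 then a else 0) + (if i.val + 1 = n then b else 0)) ^ 2 ≤
      2 * a ^ 2 + 2 * b ^ 2 := by
    calc _ ≤ ∑ i : Fin n, ((if i.val = 0 then 2 * a ^ 2 else 0)
          + (if i.val = n - 1 then 2 * b ^ 2 else 0)) := by
          refine Finset.sum_le_sum fun i _ => ?_
          have hi : i.val + 1 = n ↔ i.val = n - 1 := by have := i.isLt; omega
          simp only [hi]
          split_ifs <;> nlinarith [sq_nonneg (a - b), sq_nonneg a, sq_nonneg b]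
      _ = 2 * a ^ 2 + 2 * b ^ 2 := by
          rw [Finset.sum_add_distrib,
            Fin.sum_univ_eq_sum_range (fun i => if i = 0 then 2 * a ^ 2 else 0),
            Fin.sum_univ_eq_sum_range (fun i => if i = n - 1 then 2 * b ^ 2 else 0),
            Finset.sum_ite_eq', Finset.sum_ite_eq', if_pos (Finset.mem_range.mpr (by omega)),
            if_pos (Finset.mem_range.mpr (by omega))]
  exact (mul_le_mul_of_nonneg_left h3 (sq_nonneg _)).trans (h2.trans h5)

theorem tendsto_infDist_of_det_eq_zero {ρ ε z : ℝ} {h : ℕ} (hh : 1 ≤ h) (hρ0 : ρ ≠ 0)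
    (hερ : ε + ρ ≠ 0) (hz : z ∉ Set.Icc (lowerEdge ρ) (upperEdge ρ))
    (hdet : (M ρ ε h z).det = 0) {k : ℕ → ℕ} (hk : Tendsto k atTop atTop)
    (hnk : Tendsto (fun n : ℕ => (n : ℤ) - (k n : ℤ)) atTop atTop) :
    Tendsto (fun n => Metric.infDist z
      (spectrum ℝ (bidiagonalGram (intervalCoeff ρ ε h (k n)) n))) atTop (𝓝 0) := by
  obtain ⟨u, hu0, hu⟩ := Matrix.exists_mulVec_eq_zero_iff.mpr hdet
  obtain ⟨⟨hx1, hx2⟩, hx0⟩ := fInv_mem hρ0 hz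
  set x := fInv ρ z
  set U : ℕ → ℝ := fun j => if hj : j < h + 1 then u ⟨j, hj⟩ else 0 with hU
  have hUu : (fun j : Fin (h + 1) => U j.val) = u := by
    ext j
    simp only [hU]
    rw [dif_pos j.isLt]
  obtain ⟨j, hj⟩ := Function.ne_iff.mp hu0
  rw [← hUu] at hj hu
  have hj2 : 0 < U j.val ^ 2 := by
    have : U j.val ≠ 0 := hj
    positivity
  -- The window starts at `K = k n - 1`, one row before the break. Natural subtraction is exact once
  -- `k n ≥ 1`.
  have hK : Tendsto (fun n => k n - 1) atTop atTop := (tendsto_sub_atTop_nat 1).comp hk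
  have hR : Tendsto (fun n => n - (k n - 1 + h)) atTop atTop := by
    rw [tendsto_atTop]
    intro b
    filter_upwards [tendsto_atTop.mp hnk (b + h)] with n hn
    omega
  have hpow : Tendsto (fun m : ℕ => x ^ m) atTop (𝓝 0) :=
    tendsto_pow_atTop_nhds_zero_of_abs_lt_one (abs_lt.mpr ⟨hx1, hx2⟩)
  have hlim : Tendsto (fun n => (2 * (ρ * (x ^ (k n - 1) * U 0)) ^ 2
      + 2 * (ρ * ((x - ρ) * (x ^ (n - (k n - 1 + h)) * U h))) ^ 2) / U j.val ^ 2) atTop (𝓝 0) := by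
    have h1 := ((((hpow.comp hK).mul_const (U 0)).const_mul ρ).pow 2).const_mul 2
    have h2 := (((((hpow.comp hR).mul_const (U h)).const_mul (x - ρ)).const_mul ρ).pow 2).const_mul 2
    have h3 := (h1.add h2).div_const (U j.val ^ 2)
    simpa using h3
  have hsqrt := (Real.continuous_sqrt.tendsto 0).comp hlim
  rw [Real.sqrt_zero] at hsqrt
  refine squeeze_zero' (Eventually.of_forall fun n => Metric.infDist_nonneg) ?_ hsqrt
  filter_upwards [tendsto_atTop.mp hK 1, tendsto_atTop.mp hR 1] with n h1 h2
  have h3 := infDist_sq_mul_le_of_mulVec_eq_zero hh hερ hx0 (f_fInv hρ0 hz) hu h1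
    (n := n) (by omega) (j := j.val) (by have := j.isLt; omega)
  rw [show k n - 1 + 1 = k n by omega] at h3
  exact Real.le_sqrt_of_sq_le ((le_div_iff₀ hj2).mpr h3)

/-! ### Limits of eigenvalues are roots of the determinant -/

/-- The accumulated errors form a geometric series with sum at most `e / (1 - q)`, the fixed point
of `s ↦ q s + e`. -/
theorem abs_le_of_abs_succ_le {q e : ℝ} (hq0 : 0 ≤ q) (hq1 : q < 1) (he : 0 ≤ e) {a : ℕ → ℝ} :
    ∀ {m : ℕ}, (∀ i < m, |a (i + 1)| ≤ q * |a i| + e) → |a m| ≤ q ^ m * |a 0| + e / (1 - q) := by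
  intro m
  induction m with
  | zero =>
    intro _
    have : 0 ≤ e / (1 - q) := div_nonneg he (by linarith)
    simpa using this
  | succ m ih =>
    intro hm
    have h1 := ih fun i hi => hm i (by omega)
    have h2 := mul_le_mul_of_nonneg_left h1 hq0
    have h3 : e / (1 - q) = q * (e / (1 - q)) + e := by
      have : 1 - q ≠ 0 := by linarith
      field_simp
      ring
    rw [pow_succ']
    linarith [hm m (by omega)]

/-- From `u = A⁻¹ (A u)`: with `S` the entrywise mass of `A⁻¹`, the choice `c = 1 / (1 + S)` makes
`S c < 1`. -/
theorem exists_le_abs_mulVec {m : ℕ} {A : Matrix (Fin m) (Fin m) ℝ} (hA : A.det ≠ 0) :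
    ∃ c > 0, ∀ u : Fin m → ℝ, (∃ i, 1 ≤ |u i|) → ∃ i, c ≤ |A.mulVec u i| := by
  set S := ∑ i, ∑ j, |A⁻¹ i j| with hS
  have hS0 : 0 ≤ S := Finset.sum_nonneg fun i _ => Finset.sum_nonneg fun j _ => abs_nonneg _
  refine ⟨1 / (1 + S), by positivity, fun u ⟨i, hi⟩ => ?_⟩
  by_contra! hc
  have h1 : u = A⁻¹.mulVec (A.mulVec u) := by
    rw [Matrix.mulVec_mulVec, Matrix.nonsing_inv_mul _ (isUnit_iff_ne_zero.mpr hA),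
      Matrix.one_mulVec]
  have h2 : |u i| ≤ S * (1 / (1 + S)) := by
    conv_lhs => rw [h1, Matrix.mulVec, dotProduct]
    calc |∑ j, A⁻¹ i j * A.mulVec u j| ≤ ∑ j, |A⁻¹ i j| * (1 / (1 + S)) := by
          refine (Finset.abs_sum_le_sum_abs _ _).trans (Finset.sum_le_sum fun j _ => ?_)
          rw [abs_mul]
          exact mul_le_mul_of_nonneg_left (hc j).le (abs_nonneg _)
      _ ≤ S * (1 / (1 + S)) := by
          rw [← Finset.sum_mul]
          refine mul_le_mul_of_nonneg_right ?_ (by positivity)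
          exact Finset.single_le_sum (f := fun i => ∑ j, |A⁻¹ i j|)
            (fun i _ => Finset.sum_nonneg fun j _ => abs_nonneg _) (Finset.mem_univ i)
  have h3 : S * (1 / (1 + S)) < 1 := by
    rw [mul_one_div, div_lt_one (by positivity)]
    linarith
  linarith

/-- Multiplied by `|x|`, this is `(1 - |x|)² > 0`. -/
theorem two_lt_abs_add_inv {x : ℝ} (hx0 : x ≠ 0) (hx1 : |x| < 1) : 2 < |x + x⁻¹| := by
  have hpos : 0 < |x| := abs_pos.mpr hx0
  have h1 : |x + x⁻¹| * |x| = |x| ^ 2 + 1 := by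
    rw [← abs_mul, add_mul, inv_mul_cancel₀ hx0, sq_abs, ← sq,
      abs_of_pos (by positivity : 0 < x ^ 2 + 1)]
  nlinarith [mul_pos (sub_pos.mpr hx1) (sub_pos.mpr hx1)]

/-- If `det M ≠ 0`, an eigenvalue of `LᵀL` cannot be too close to `z`: an eigenvector attains its
maximum in the window, and is there an approximate solution of `M u = 0`. -/
theorem eigenvalue_far_or {ρ ε z c : ℝ} {h : ℕ} (hh : 1 ≤ h) (hρ : |ρ| < 1) (hρ0 : ρ ≠ 0)
    (hερ : ε + ρ ≠ 0) (hz : z ∉ Set.Icc (lowerEdge ρ) (upperEdge ρ))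
    (hc : ∀ u : Fin (h + 1) → ℝ, (∃ i, 1 ≤ |u i|) → ∃ i, c ≤ |(M ρ ε h z).mulVec u i|)
    {K n : ℕ} (hK : 1 ≤ K) (hn : K + h < n) {δ : ℝ}
    (hδ : Metric.infDist z (spectrum ℝ (bidiagonalGram (intervalCoeff ρ ε h (K + 1)) n)) = δ) :
    |ρ| * |fInv ρ z + (fInv ρ z)⁻¹| ≤ 2 * |ρ| + δ ∨
      |ε + ρ| * c ≤ δ + |ρ| * (2 * |fInv ρ z| ^ (K - 1) + 2 * |fInv ρ z| ^ (n - (K + h))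
        + 2 * (δ / |ρ| / (1 - |fInv ρ z|))) := by
  obtain ⟨l, V, hd, hV0, hVn, hle, ⟨t₀, ht1, htn, ht₀⟩, heq⟩ :=
    exists_nearest_eigensequence (intervalCoeff ρ ε h (K + 1)) (n := n) (by omega) z
  have hfz := f_fInv hρ0 hz
  obtain ⟨⟨hx1, hx2⟩, hx0⟩ := fInv_mem hρ0 hz
  rw [hδ] at hd
  set r := intervalCoeff ρ ε h (K + 1) with hr
  set x := fInv ρ z with hx
  have hx0 : x ≠ 0 := hx0
  have hxa : |x| < 1 := abs_lt.mpr ⟨hx1, hx2⟩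
  have hρp : 0 < |ρ| := abs_pos.mpr hρ0
  have hδ0 : 0 ≤ δ := hd ▸ abs_nonneg _
  have hrn : r (n + 1) = ρ := by rw [hr, intervalCoeff, if_neg (by omega), add_zero]
  rw [hrn] at hVn
  -- `|ρ| < 1` keeps the ghost value at `n + 1` within the same bound.
  have hle' : ∀ t ≤ n + 1, |V t| ≤ 1 := by
    intro t ht
    rcases Nat.lt_or_ge n t with h1 | h1
    · rw [show t = n + 1 by omega, hVn, abs_mul]
      exact mul_le_one₀ hρ.le (abs_nonneg _) (hle n le_rfl)
    · exact hle t h1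
  have hrow : ∀ t, 1 ≤ t → t ≤ n → rowOp r z V t = (l - z) * V t := by
    intro t h1 h2
    rw [rowOp]
    linear_combination heq t h1 h2
  have hrow' : ∀ t, 1 ≤ t → t ≤ n → |rowOp r z V t| ≤ δ := by
    intro t h1 h2
    rw [hrow t h1 h2, abs_mul, hd]
    exact mul_le_of_le_one_right hδ0 (hle t h2)
  have hbulk : ∀ t, 1 ≤ t → t ≤ n → t < K ∨ K + h < t →
      |(x + x⁻¹) * V t - V (t - 1) - V (t + 1)| ≤ δ / |ρ| := by
    intro t h1 h2 h3
    rw [le_div_iff₀' hρp, ← abs_mul, ← rowOp_intervalCoeff_bulk hfz V h3]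
    exact hrow' t h1 h2
  by_cases hwin : K ≤ t₀ ∧ t₀ ≤ K + h
  · right
    obtain ⟨i, hi⟩ := hc (fun j => V (K + j.val)) ⟨⟨t₀ - K, by omega⟩, by
      simp only [Nat.add_sub_cancel' hwin.1, ht₀, le_refl]⟩
    have he0 : 0 ≤ δ / |ρ| := by positivity
    have hstep : ∀ a b g : ℝ, a = x * b + x * g → |g| ≤ δ / |ρ| → |a| ≤ |x| * |b| + δ / |ρ| := by
      intro a b g h1 h2
      rw [h1]
      refine (abs_add_le _ _).trans ?_
      rw [abs_mul, abs_mul]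
      exact add_le_add le_rfl ((mul_le_of_le_one_left (abs_nonneg _) hxa.le).trans h2)
    have htwo : ∀ a b y : ℝ, |a| ≤ 1 → |b| ≤ 1 → |y| ≤ 1 → |a - y * b| ≤ 2 := by
      intro a b y h1 h2 h3
      refine (abs_sub _ _).trans ?_
      rw [abs_mul]
      linarith [mul_le_one₀ h3 (abs_nonneg _) h2]
    -- The defect `V t - x V (t+1)` contracts by `|x|` at each step towards the window, up to `δ /
    -- |ρ|`: the growing solution is damped. It starts from at most `2` at the boundary.
    have hleft : |V (K - 1) - x * V K| ≤ |x| ^ (K - 1) * 2 + δ / |ρ| / (1 - |x|) := by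
      have h1 := abs_le_of_abs_succ_le (abs_nonneg x) hxa he0
        (a := fun t => V t - x * V (t + 1)) (m := K - 1) fun t ht =>
          hstep _ _ ((x + x⁻¹) * V (t + 1) - V (t + 1 - 1) - V (t + 1 + 1)) (by
            simp only [Nat.add_sub_cancel]
            field_simp
            ring) (hbulk (t + 1) (by omega) (by omega) (Or.inl (by omega)))
      simp only [Nat.sub_add_cancel hK] at h1
      refine h1.trans (add_le_add (mul_le_mul_of_nonneg_left ?_ (by positivity)) le_rfl)
      exact htwo _ _ _ (hle' _ (by omega)) (hle' _ (by omega)) hxa.le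
    -- The same contraction, run backwards from the right end via `t ↦ n - t`.
    have hright : |V (K + h + 1) - x * V (K + h)| ≤
        |x| ^ (n - (K + h)) * 2 + δ / |ρ| / (1 - |x|) := by
      have h1 := abs_le_of_abs_succ_le (abs_nonneg x) hxa he0
        (a := fun t => V (n - t + 1) - x * V (n - t)) (m := n - (K + h)) fun t ht =>
          hstep _ _ ((x + x⁻¹) * V (n - t) - V (n - t - 1) - V (n - t + 1)) (by
            simp only [show n - (t + 1) = n - t - 1 by omega,
              show n - t - 1 + 1 = n - t by omega]
            field_simp
            ring) (hbulk (n - t) (by omega) (by omega) (Or.inr (by omega)))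
      simp only [show n - (n - (K + h)) = K + h by omega, Nat.sub_zero] at h1
      refine h1.trans (add_le_add (mul_le_mul_of_nonneg_left ?_ (by positivity)) le_rfl)
      exact htwo _ _ _ (hle' _ (by omega)) (hle' _ (by omega)) hxa.le
    have hrowi := hrow' (K + i.val) (by omega) (by have := i.isLt; omega)
    have hw := rowOp_intervalCoeff_window (K := K) hh hερ hfz V i
    rw [← hr, ← hx] at hw
    have hl0 := mul_le_mul_of_nonneg_left hleft hρp.le
    have hr0 := mul_le_mul_of_nonneg_left hright hρp.le
    rw [← abs_mul] at hl0 hr0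
    have hl1 : |if i.val = 0 then ρ * (V (K - 1) - x * V K) else 0| ≤
        |ρ| * (|x| ^ (K - 1) * 2 + δ / |ρ| / (1 - |x|)) := by
      split_ifs
      · exact hl0
      · rw [abs_zero]
        exact (abs_nonneg _).trans hl0
    have hr1 : |if i.val = h then ρ * (V (K + h + 1) - x * V (K + h)) else 0| ≤
        |ρ| * (|x| ^ (n - (K + h)) * 2 + δ / |ρ| / (1 - |x|)) := by
      split_ifs
      · exact hr0
      · rw [abs_zero]
        exact (abs_nonneg _).trans hr0
    have h5 : (ε + ρ) * (M ρ ε h z).mulVec (fun j => V (K + j.val)) i =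
        rowOp r z V (K + i.val) + (if i.val = 0 then ρ * (V (K - 1) - x * V K) else 0)
          + (if i.val = h then ρ * (V (K + h + 1) - x * V (K + h)) else 0) := by
      linarith
    have h6 := (abs_add_three (rowOp r z V (K + i.val)) _ _).trans
      (add_le_add (add_le_add hrowi hl1) hr1)
    rw [← h5, abs_mul] at h6
    refine (mul_le_mul_of_nonneg_left hi (abs_nonneg _)).trans (h6.trans (le_of_eq ?_))
    ring
  -- The maximum lies in the bulk: there the recursion bounds `|x + x⁻¹|` by two neighbours of
  -- modulus at most `1` plus the error.
  · left
    have h1 := hbulk t₀ ht1 htn (by omega)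
    have h2 : |x + x⁻¹| ≤ 2 + δ / |ρ| := by
      have h3 : (x + x⁻¹) * V t₀ =
          ((x + x⁻¹) * V t₀ - V (t₀ - 1) - V (t₀ + 1)) + V (t₀ - 1) + V (t₀ + 1) := by ring
      have h4 : |(x + x⁻¹) * V t₀| ≤ δ / |ρ| + 1 + 1 := by
        rw [h3]
        exact (abs_add_three _ _ _).trans
          (add_le_add (add_le_add h1 (hle' _ (by omega))) (hle' _ (by omega)))
      rw [abs_mul, ht₀, mul_one] at h4
      linarith
    refine (mul_le_mul_of_nonneg_left h2 hρp.le).trans (le_of_eq ?_)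
    field_simp

theorem det_eq_zero_of_tendsto_infDist {ρ ε z : ℝ} {h : ℕ} (hh : 1 ≤ h) (hρ : |ρ| < 1)
    (hρ0 : ρ ≠ 0) (hερ : ε + ρ ≠ 0) (hz : z ∉ Set.Icc (lowerEdge ρ) (upperEdge ρ)) {k : ℕ → ℕ}
    (hk : Tendsto k atTop atTop)
    (hnk : Tendsto (fun n : ℕ => (n : ℤ) - (k n : ℤ)) atTop atTop)
    (hlim : Tendsto (fun n => Metric.infDist z
      (spectrum ℝ (bidiagonalGram (intervalCoeff ρ ε h (k n)) n))) atTop (𝓝 0)) :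
    (M ρ ε h z).det = 0 := by
  by_contra hdet
  obtain ⟨c, hc0, hc⟩ := exists_le_abs_mulVec hdet
  obtain ⟨⟨hx1, hx2⟩, hx0⟩ := fInv_mem hρ0 hz
  have hxa : |fInv ρ z| < 1 := abs_lt.mpr ⟨hx1, hx2⟩
  have hρp : 0 < |ρ| := abs_pos.mpr hρ0
  have hs := two_lt_abs_add_inv hx0 hxa
  set x := fInv ρ z
  have hK : Tendsto (fun n => k n - 1 - 1) atTop atTop :=
    ((tendsto_sub_atTop_nat 1).comp (tendsto_sub_atTop_nat 1)).comp hk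
  have hR : Tendsto (fun n => n - (k n - 1 + h)) atTop atTop := by
    rw [tendsto_atTop]
    intro b
    filter_upwards [tendsto_atTop.mp hnk (b + h)] with n hn
    omega
  have hpow : Tendsto (fun m : ℕ => |x| ^ m) atTop (𝓝 0) :=
    tendsto_pow_atTop_nhds_zero_of_lt_one (abs_nonneg x) hxa
  set δ : ℕ → ℝ := fun n => Metric.infDist z
    (spectrum ℝ (bidiagonalGram (intervalCoeff ρ ε h (k n)) n)) with hδ
  have hA : Tendsto (fun n => 2 * |ρ| + δ n) atTop (𝓝 (2 * |ρ|)) := by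
    simpa using hlim.const_add (2 * |ρ|)
  have hB : Tendsto (fun n => δ n + |ρ| * (2 * |x| ^ (k n - 1 - 1)
      + 2 * |x| ^ (n - (k n - 1 + h)) + 2 * (δ n / |ρ| / (1 - |x|)))) atTop (𝓝 0) := by
    have h1 := (((hpow.comp hK).const_mul 2).add ((hpow.comp hR).const_mul 2)).add
      (((hlim.div_const |ρ|).div_const (1 - |x|)).const_mul 2)
    simpa using hlim.add (h1.const_mul |ρ|)
  -- Both alternatives of `eigenvalue_far_or` fail for large `n`: the first because `|x + x⁻¹| > 2`,
  -- the second because its right side tends to `0`.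
  have hA' := hA.eventually (gt_mem_nhds (show 2 * |ρ| < |ρ| * |x + x⁻¹| by nlinarith))
  have hB' := hB.eventually (gt_mem_nhds
    (show 0 < |ε + ρ| * c from mul_pos (abs_pos.mpr hερ) hc0))
  obtain ⟨n, h1, h2, h3, h4⟩ := (hA'.and (hB'.and ((tendsto_atTop.mp hk 2).and
    (tendsto_atTop.mp hR 1)))).exists
  have h5 := eigenvalue_far_or hh hρ hρ0 hερ hz hc (K := k n - 1) (n := n) (by omega) (by omega)
    (δ := δ n) (by rw [show k n - 1 + 1 = k n by omega])
  rcases h5 with h5 | h5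
  · exact absurd h5 (not_le.mpr h1)
  · exact absurd h5 (not_le.mpr h2)

end

end SCM

theorem theorem3p4 {Ω : Type*} [MeasurableSpace Ω] (P : MeasureTheory.Measure Ω)
    [MeasureTheory.IsProbabilityMeasure P] (w : ℕ → Ω → ℝ) (hw : SCM.IsWhiteNoise w P)
    (ρ ε : ℝ) (hρ : |ρ| < 1) (hρ0 : ρ ≠ 0) (hε : ε ≠ 0) (hερ : ε + ρ ≠ 0)
    (h : ℕ) (hh : 1 ≤ h) (k : ℕ → ℕ)
    (hk : Filter.Tendsto k Filter.atTop Filter.atTop)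
    (hnk : Filter.Tendsto (fun n : ℕ => (n : ℤ) - (k n : ℤ)) Filter.atTop Filter.atTop) :
    (∃ μ : MeasureTheory.Measure ℝ, SCM.IsASD (SCM.intervalPrecision P w ρ ε h k) μ) ∧
    ∀ z : ℝ, z ∈ SCM.outliers (SCM.intervalPrecision P w ρ ε h k) ↔
      z ∉ Set.Icc (SCM.lowerEdge ρ) (SCM.upperEdge ρ) ∧ (SCM.M ρ ε h z).det = 0 := by
  have hB : SCM.intervalPrecision P w ρ ε h k =
      fun n => SCM.bidiagonalGram (SCM.intervalCoeff ρ ε h (k n)) n :=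
    funext fun n => SCM.precisionMatrix_arProcess hw _ n
  have hasd := SCM.isASD_bidiagonalGram hρ0 ε h k
  have hsupp := SCM.support_symbolLaw hρ0
  rw [hB]
  refine ⟨⟨_, hasd⟩, fun z => ⟨?_, ?_⟩⟩
  · rintro ⟨μ, hμ, hz, hlim⟩
    rw [hμ.unique hasd, hsupp, isClosed_Icc.closure_eq] at hz
    exact ⟨hz, SCM.det_eq_zero_of_tendsto_infDist hh hρ hρ0 hερ hz hk hnk hlim⟩
  · rintro ⟨hz, hdet⟩
    refine ⟨_, hasd, ?_, SCM.tendsto_infDist_of_det_eq_zero hh hρ0 hερ hz hdet hk hnk⟩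
    rwa [hsupp, isClosed_Icc.closure_eq]
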